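/- **Conventions.** An action of a group $G$ on a simplicial tree $S$ is by graph automorphisms and without inversion (no element of $G$ flips an edge); $V(S)$ is the set of vertices and $E(S)$ the set of edges of $S$. The action is *non-trivial* if $G$ has no global fixed point in $S$. For an edge $e$, $G(e)$ denotes the pointwise stabilizer of $e$ in $G$. An *epimorphism* $(\phi,f)$ from an action of $G$ on $S$ to an action of $G'$ on $S'$ consists of a surjective homomorphism $\phi:G\to G'$ and a $\phi$-equivariant continuous map $f:S\to S'$ that sends each vertex to a vertex and each edge to an edge path of $S'$, possibly degenerate (reduced to a vertex). A group $G$ has a *non-trivial splitting over* a subgroup $C$ if $G$ acts non-trivially on a simplicial tree with exactly one orbit of unoriented edges, in such a way that $C$ is the stabilizer of an edge (equivalently, $G$ is a non-trivial amalgamated product over $C$ or an HNN extension over $C$). **Theorem (Extended Scott's Lemma).** For $k\in\mathbb N$, let $G_k$ be a finitely generated group with a non-trivial action on a simplicial tree $S_k$, and let $(\phi_k,f_k)$ be an epimorphism from the action of $G_k$ on $S_k$ to the action of $G_{k+1}$ on $S_{k+1}$. Assume that $(\phi_k,f_k)$ does not increase edge stabilizers, in the following sense: for every $k$, $$\forall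 e\in E(S_k),\ \forall e'\in E(S_{k+1}),\qquad e'\subset f_k(e)\ \Longrightarrow\ G_{k+1}(e')=\phi_k(G_k(e)).$$ Let $G=\varinjlim G_k$ be the direct limit of the sequence $G_0\xrightarrow{\phi_0}G_1\xrightarrow{\phi_1}\cdots$, with canonical homomorphisms $\Phi_k:G_k\to G$. Then there exist $k\in\mathbb N$ and an edge $e$ of $S_k$ such that $G$ has a non-trivial splitting over $\Phi_k(G_k(e))$. -/

import Mathlib

universe u v w

section TreeActions

/-- The simple graph `S` is a simplicial tree on which `G` acts (through its vertices) by graph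
automorphisms, without inversion: no element of `G` flips an edge. -/
structure IsTreeAction (G : Type*) [Group G] {V : Type*} [MulAction G V]
    (S : SimpleGraph V) : Prop where
  isTree : S.IsTree
  smul_adj : ∀ (g : G) {x y : V}, S.Adj x y → S.Adj (g • x) (g • y)
  no_inversion : ∀ (g : G) {x y : V}, S.Adj x y → ¬ (g • x = y ∧ g • y = x)

/-- The action has no global fixed point. For a simplicial action without inversion on a tree, a
point of the geometric realization is fixed by `G` only if some vertex is, so it suffices to look
at vertices. -/
def IsNontrivialAction (G : Type*) [Group G] (V : Type*) [MulAction G V] : Prop :=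
  ¬ ∃ x : V, ∀ g : G, g • x = x

/-- The pointwise stabilizer of the edge with endpoints `x` and `y`. -/
def edgeStabilizer (G : Type*) [Group G] {V : Type*} [MulAction G V] (x y : V) : Subgroup G :=
  MulAction.stabilizer G x ⊓ MulAction.stabilizer G y

/-- An epimorphism `(φ, f)` from the action of `G` on `S` to the action of `G'` on `S'`: an onto
homomorphism `φ : G → G'` and a `φ`-equivariant map `f : S → S'` sending each vertex to a vertex
and each edge to an edge path, which may be degenerate (of length `0`) and may backtrack. The path
`edgeMap h` is the image of the edge `h`, traversed from `x` to `y`. -/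
structure TreeEpimorphism (G : Type*) [Group G] {V : Type*} [MulAction G V] (S : SimpleGraph V)
    (G' : Type*) [Group G'] {V' : Type*} [MulAction G' V'] (S' : SimpleGraph V') where
  hom : G →* G'
  hom_surjective : Function.Surjective hom
  vertexMap : V → V'
  vertexMap_smul : ∀ (g : G) (x : V), vertexMap (g • x) = hom g • vertexMap x
  edgeMap : ∀ {x y : V}, S.Adj x y → S'.Walk (vertexMap x) (vertexMap y)
  edgeMap_symm : ∀ {x y : V} (h : S.Adj x y), edgeMap h.symm = (edgeMap h).reverse
  edgeMap_smul : ∀ (g : G) {x y : V} (h : S.Adj x y) (h' : S.Adj (g • x) (g • y)),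
    (edgeMap h').support = (edgeMap h).support.map (fun z => hom g • z)

/-- `(φ, f)` does not increase edge stabilizers: whenever an edge `e'` of `S'` is contained in the
image of an edge `e` of `S`, one has `G'(e') = φ(G(e))`. -/
def TreeEpimorphism.PreservesEdgeStabilizers {G : Type*} [Group G] {V : Type*} [MulAction G V]
    {S : SimpleGraph V} {G' : Type*} [Group G'] {V' : Type*} [MulAction G' V']
    {S' : SimpleGraph V'} (F : TreeEpimorphism G S G' S') : Prop :=
  ∀ {x y : V} (h : S.Adj x y) (x' y' : V'), s(x', y') ∈ (F.edgeMap h).edges →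
    edgeStabilizer G' x' y' = (edgeStabilizer G x y).map F.hom

/-- `G` has a non-trivial (one-edge) splitting over the subgroup `C`: there is an action of `G`
without inversion on a simplicial tree, without global fixed point, with a single orbit of
unoriented edges, such that `C` is the stabilizer of an edge. By Bass-Serre theory this says that
`G` is a non-trivial amalgamated product or an HNN extension over `C`. The universe `w` is the one
in which the vertex set lives. -/
def HasNontrivialSplittingOver (G : Type u) [Group G] (C : Subgroup G) : Prop :=
  ∃ (W : Type w) (_ : MulAction G W) (T : SimpleGraph W),
    IsTreeAction G T ∧ IsNontrivialAction G W ∧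
    (∀ a b a' b' : W, T.Adj a b → T.Adj a' b' →
      ∃ g : G, (g • a = a' ∧ g • b = b') ∨ (g • a = b' ∧ g • b = a')) ∧
    ∃ a b : W, T.Adj a b ∧ edgeStabilizer G a b = C

end TreeActions

section SequentialLimit

/-- The composite `G i → G (i + 1) → ⋯ → G j`. -/
def seqMap {G : ℕ → Type u} [∀ k, Group (G k)] (φ : ∀ k, G k →* G (k + 1))
    {i j : ℕ} (h : i ≤ j) : G i →* G j :=
  Nat.leRecOn (C := fun n => G i →* G n) h (fun {k} ψ => (φ k).comp ψ) (MonoidHom.id (G i))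

theorem seqMap_self {G : ℕ → Type u} [∀ k, Group (G k)] (φ : ∀ k, G k →* G (k + 1)) (i : ℕ) :
    seqMap φ (le_refl i) = MonoidHom.id (G i) :=
  Nat.leRecOn_self (C := fun n => G i →* G n) _

theorem seqMap_succ {G : ℕ → Type u} [∀ k, Group (G k)] (φ : ∀ k, G k →* G (k + 1))
    {i j : ℕ} (h : i ≤ j) :
    seqMap φ (Nat.le_succ_of_le h) = (φ j).comp (seqMap φ h) :=
  Nat.leRecOn_succ (C := fun n => G i →* G n) h _

instance seqMap_directedSystem {G : ℕ → Type u} [∀ k, Group (G k)] (φ : ∀ k, G k →* G (k + 1)) :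
    DirectedSystem G (fun _ _ h => seqMap φ h) where
  map_self i x := by
    rw [seqMap_self]
    rfl
  map_map k j i hij hjk x := by
    induction k, hjk using Nat.le_induction with
    | base => rw [seqMap_self]; rfl
    | succ k hjk ih =>
      rw [seqMap_succ φ hjk, seqMap_succ φ (hij.trans hjk), MonoidHom.comp_apply, ih,
        MonoidHom.comp_apply]

/-- The direct limit of the sequence of groups `G 0 → G 1 → G 2 → ⋯`. -/
abbrev SeqLimit {G : ℕ → Type u} [∀ k, Group (G k)] (φ : ∀ k, G k →* G (k + 1)) : Type u :=
  DirectLimit G (fun _ _ h => seqMap φ h)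

/-- The canonical homomorphism from `G k` to the direct limit. -/
noncomputable def toSeqLimit {G : ℕ → Type u} [∀ k, Group (G k)] (φ : ∀ k, G k →* G (k + 1)) (k : ℕ) :
    G k →* SeqLimit φ :=
  MonoidHom.mk' (fun x => (⟦⟨k, x⟩⟧ : SeqLimit φ)) (fun x y => (DirectLimit.mul_def k x y).symm)

end SequentialLimit

/-!
Let `H = G 0`, which maps onto the limit with kernel `N`; every `S k` is an `H`-tree on which each
element of `N` eventually acts trivially as `k` grows. The theorem is proved by finding one
`H`-tree with finitely many orbits of edges on which all of `N` acts trivially, so that it is a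
tree for the limit, and collapsing it to a single orbit of edges.

Call a tree `T` *reduced* (`IsReduced`) if every element of `N` fixing a vertex acts trivially on
`T`. Dividing `S k` by the elements of `N` that fix a vertex gives a reduced tree `R k`
(`exists_reduction`). The maps considered (`IsFold`) are those which do not increase edge
stabilizers modulo `N`; the maps `S k → S (k + 1)` induce such maps `R k → R (k + 1)`. Among all
reduced trees with finitely many orbits of vertices and edges that map to some `R j`, choose `T`
minimizing first the number of homomorphisms `H → ℤ/2` that vanish on vertex stabilizers, then the
number of orbits of branch vertices, that is, of vertices whose stabilizer does not fix all their
neighbours (`complexity`, `IsMinimal`).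

The key claim is that elements of `N` acting trivially on `R j` act trivially on `T`, whenever `T`
maps to `R j` (`IsMinimal.trivial_of_isFold`). After subdividing, which does not change the
complexity, the map sends edges to edges or vertices. If it is injective, the claim is clear.
Otherwise it collapses an edge or folds two edges, that is, it identifies two vertices `y`, `z` at
distance at most 2. These lie in different orbits: if `z = g • y`, then `g` is elliptic in the image
of `T` but not killed by the parity homomorphism counting the crossings of an orbit of edges, so
that the image of `T` would have fewer homomorphisms to `ℤ/2` (`IsMinimal.smul_ne`). That two
edges in the same orbit cannot be folded is where the hypothesis on edge stabilizers enters. Now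
merge `y` and `z` equivariantly and reduce. No new orbits of branch vertices appear, and if both
`y` and `z` were branch vertices their number would drop. Hence one of them is not, the stabilizer
of the merged vertex is just that of `y` or of `z`, and no element of `N` becomes trivial in the
process (`IsMinimal.exists_merge`). The claim follows by induction on the number of orbits of
vertices.

Since `T` maps to all `R j` with `j` large, and every element of `N` acts trivially on one of these,
`N` acts trivially on `T` (`exists_trivial_isFold`). Finite generation shows that `R j` has no fixed
vertex (`not_fixed_mod_ker`), and a Helly type argument then gives an edge of `T` which is not
collapsed in `R j` and such that collapsing all edges outside its orbit leaves an action without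
fixed vertex (`exists_nontrivial_collapse`).

That the various quotients are trees is always checked by means of two-colourings of the vertices
that change along a prescribed set of edges (`IsCut`), through
`isTree_of_forall_adj_exists_cut`.
-/

/-! ### Cuts in a tree -/

section Cuts

variable {V : Type*} {T : SimpleGraph V}

/-- A two-colouring `c` of the vertices of `T` which changes exactly along the edges in `D`. -/
def IsCut (T : SimpleGraph V) (D : Set (Sym2 V)) (c : V → ZMod 2) : Prop :=
  ∀ u v, T.Adj u v → (c u ≠ c v ↔ s(u, v) ∈ D)

/-- The edge `pq` of the tree `T` separates the vertices `a` and `b`, that is, lies on the geodesic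
between them. The cut along one edge of a tree is unique up to exchanging the colours, so that it
does not matter which one is used. If `p` and `q` are not adjacent, no vertices are separated. -/
def Separates (T : SimpleGraph V) (p q a b : V) : Prop :=
  ∀ c, IsCut T {s(p, q)} c → c a ≠ c b

theorem SimpleGraph.Reachable.eq_of_forall_adj_eq {X : Type*} {f : V → X} {a b : V}
    (hab : T.Reachable a b) (hf : ∀ u v, T.Adj u v → f u = f v) : f a = f b := by
  obtain ⟨w⟩ := hab
  induction w with
  | nil => rfl
  | cons h _ ih => exact (hf _ _ h).trans ih

theorem eq_of_forall_adj_eq {X : Type*} (hT : T.Preconnected) {f : V → X}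
    (hf : ∀ u v, T.Adj u v → f u = f v) (a b : V) : f a = f b :=
  (hT a b).eq_of_forall_adj_eq hf

/-- Colour a vertex by the parity of the number of edges in `D` on the path from a base point. -/
theorem SimpleGraph.IsTree.exists_isCut (hT : T.IsTree) (D : Set (Sym2 V)) :
    ∃ c, IsCut T D c := by
  classical
  obtain ⟨r⟩ := hT.connected.nonempty
  choose p hp _ using fun v => hT.existsUnique_path r v
  refine ⟨fun v => ((p v).edges.countP (· ∈ D) : ℕ), ?_⟩
  -- one of the paths from the root to `u` and `v` extends the other one by the edge `uv`
  have key : ∀ u v (h : T.Adj u v), v ∉ (p u).support →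
      ((((p u).edges.countP (· ∈ D) : ℕ) : ZMod 2) ≠ (((p v).edges.countP (· ∈ D) : ℕ) : ZMod 2) ↔
        s(u, v) ∈ D) := by
    intro u v h hv
    have : p v = (p u).concat h :=
      (hT.existsUnique_path r v).unique (hp v) ((hp u).concat hv h)
    rw [this, SimpleGraph.Walk.edges_concat, List.concat_eq_append, List.countP_append]
    by_cases hd : s(u, v) ∈ D
    · simp [hd]
    · simp [hd]
  intro u v h
  by_cases hv : v ∈ (p u).support
  · have hu : u ∉ (p v).support := fun hu =>
      (hT.isAcyclic.ne_mem_support_of_support_of_adj_of_isPath (hp u) (hp v) h hv) hu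
    rw [ne_comm, key v u h.symm hu, Sym2.eq_swap]
  · exact key u v h hv

theorem ZMod.two_add_eq_add_of_ne_iff : ∀ {a b c d : ZMod 2}, (a ≠ b ↔ c ≠ d) →
    a + c = b + d := by decide

theorem ZMod.two_eq_iff_of_add_eq_add : ∀ {a b c d : ZMod 2}, a + c = b + d →
    (a = b ↔ c = d) := by decide

theorem IsCut.eq_iff_eq (hT : T.Preconnected) {D : Set (Sym2 V)} {c c' : V → ZMod 2}
    (hc : IsCut T D c) (hc' : IsCut T D c') (a b : V) : c a = c b ↔ c' a = c' b :=
  ZMod.two_eq_iff_of_add_eq_add (eq_of_forall_adj_eq hT (f := fun v => c v + c' v)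
    (fun u v h => ZMod.two_add_eq_add_of_ne_iff ((hc u v h).trans (hc' u v h).symm)) a b)

theorem IsCut.separates_iff (hT : T.Preconnected) {p q : V} {c : V → ZMod 2}
    (hc : IsCut T {s(p, q)} c) (a b : V) : Separates T p q a b ↔ c a ≠ c b :=
  ⟨fun h => h c hc, fun h _ hc' he => h ((hc.eq_iff_eq hT hc' a b).2 he)⟩

/-- A path crosses each of its edges exactly once. -/
theorem separates_of_mem_edges {a b p q : V} (w : T.Walk a b) (hw : w.IsPath)
    (he : s(p, q) ∈ w.edges) : Separates T p q a b := by
  intro c hc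
  induction w with
  | nil => simp at he
  | @cons a a' b h w ih =>
    rw [SimpleGraph.Walk.edges_cons, List.mem_cons] at he
    have hnd := hw.isTrail.edges_nodup
    rw [SimpleGraph.Walk.edges_cons, List.nodup_cons] at hnd
    have hw' := hw.of_cons
    rcases he with he | he
    · have hconst : ∀ {x y : V} (w : T.Walk x y), s(p, q) ∉ w.edges → c x = c y := by
        intro x y w hw
        induction w with
        | nil => rfl
        | @cons x x' y h w ih =>
          rw [SimpleGraph.Walk.edges_cons, List.mem_cons, not_or] at hw
          rw [← ih hw.2]
          by_contra hne
          exact hw.1 ((hc _ _ h).1 hne).symm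
      rw [← hconst w (he ▸ hnd.1)]
      exact (hc _ _ h).2 he.symm
    · have : c a = c a' := by
        by_contra hne
        have := (hc _ _ h).1 hne
        rw [Set.mem_singleton_iff] at this
        exact hnd.1 (this ▸ he)
      rw [this]
      exact ih hw' he

theorem Separates.mem_edges (hT : T.IsTree) {p q a b : V} (h : Separates T p q a b)
    (w : T.Walk a b) : s(p, q) ∈ w.edges := by
  obtain ⟨c, hc⟩ := hT.exists_isCut {s(p, q)}
  have h := h c hc
  induction w with
  | nil => exact absurd rfl h
  | @cons a a' b hadj w ih =>
    rw [SimpleGraph.Walk.edges_cons, List.mem_cons]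
    by_cases hne : c a = c a'
    · rw [hne] at h
      exact Or.inr (ih (fun c' hc' => (hc'.eq_iff_eq hT.connected.preconnected hc _ _).not.2 h) h)
    · exact Or.inl ((hc _ _ hadj).1 hne).symm

theorem Separates.adj (hT : T.IsTree) {p q a b : V} (h : Separates T p q a b) : T.Adj p q := by
  obtain ⟨w⟩ := hT.connected a b
  exact w.adj_of_mem_edges (h.mem_edges hT w)

theorem Separates.ne (hT : T.IsTree) {p q a b : V} (h : Separates T p q a b) : a ≠ b := by
  rintro rfl
  obtain ⟨c, hc⟩ := hT.exists_isCut {s(p, q)}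
  exact h c hc rfl

theorem Separates.symm {p q a b : V} (h : Separates T p q a b) : Separates T p q b a :=
  fun c hc => (h c hc).symm

theorem separates_swap {p q a b : V} : Separates T p q a b ↔ Separates T q p a b := by
  rw [Separates, Separates, Sym2.eq_swap]

theorem separates_iff_of_adj (hT : T.IsTree) {p q a b : V} (h : T.Adj a b) :
    Separates T p q a b ↔ s(a, b) = s(p, q) := by
  obtain ⟨c, hc⟩ := hT.exists_isCut {s(p, q)}
  rw [hc.separates_iff hT.connected.preconnected, hc _ _ h, Set.mem_singleton_iff]

theorem Separates.or (hT : T.IsTree) {p q a b : V} (h : Separates T p q a b) (x : V) :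
    Separates T p q a x ∨ Separates T p q x b := by
  obtain ⟨c, hc⟩ := hT.exists_isCut {s(p, q)}
  have hT' := hT.connected.preconnected
  rw [hc.separates_iff hT'] at h ⊢
  rw [hc.separates_iff hT']
  by_contra! hcon
  exact h (hcon.1.trans hcon.2)

/-- A function taking different values at `a` and `b` changes along an edge that separates
`a` from `b`. -/
theorem exists_separates_of_ne (hT : T.IsTree) {X : Type*} (f : V → X) {a b : V}
    (h : f a ≠ f b) : ∃ u v, T.Adj u v ∧ Separates T u v a b ∧ f u ≠ f v := by
  obtain ⟨w, hw, -⟩ := hT.existsUnique_path a b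
  have key : ∀ {a b : V} (w : T.Walk a b), f a ≠ f b →
      ∃ u v, T.Adj u v ∧ s(u, v) ∈ w.edges ∧ f u ≠ f v := by
    intro a b w
    induction w with
    | nil => exact fun h => absurd rfl h
    | @cons a a' b hadj w ih =>
      intro h
      by_cases hne : f a = f a'
      · obtain ⟨u, v, huv, hmem, hf⟩ := ih (hne ▸ h)
        exact ⟨u, v, huv, by simp [hmem], hf⟩
      · exact ⟨a, a', hadj, by simp, hne⟩
  obtain ⟨u, v, huv, hmem, hf⟩ := key w h
  exact ⟨u, v, huv, separates_of_mem_edges w hw hmem, hf⟩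

/-- A connected graph is a tree as soon as, for every edge, some two-colouring of the vertices
changes along this edge only. -/
theorem isTree_of_forall_adj_exists_cut (hT : T.Connected)
    (h : ∀ a b, T.Adj a b → ∃ c : V → ZMod 2, c a ≠ c b ∧
      ∀ u v, T.Adj u v → c u ≠ c v → s(u, v) = s(a, b)) : T.IsTree := by
  refine ⟨hT, SimpleGraph.isAcyclic_iff_forall_adj_isBridge.2 fun a b hab => ?_⟩
  obtain ⟨c, hcab, hc⟩ := h a b hab
  rw [SimpleGraph.isBridge_iff]
  -- the colouring is constant on the complement of the edge
  refine fun hreach => hcab (hreach.eq_of_forall_adj_eq fun u v huv => ?_)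
  rw [SimpleGraph.deleteEdges_adj] at huv
  by_contra hne
  exact huv.2 (hc u v huv.1 hne)

end Cuts

section CutsAction

variable {H : Type*} [Group H] {V : Type*} [MulAction H V] {T : SimpleGraph V}

theorem IsTreeAction.isCut_smul (hT : IsTreeAction H T) (h : H) {D D' : Set (Sym2 V)}
    (hD : ∀ x y, s(h • x, h • y) ∈ D ↔ s(x, y) ∈ D') {c : V → ZMod 2} (hc : IsCut T D c) :
    IsCut T D' (fun v => c (h • v)) :=
  fun u v huv => (hc _ _ (hT.smul_adj h huv)).trans (hD u v)

theorem smul_mk_eq_iff (h : H) (x y p q : V) :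
    s(h • x, h • y) = s(h • p, h • q) ↔ s(x, y) = s(p, q) := by
  simp only [Sym2.eq_iff, smul_left_cancel_iff]

theorem IsTreeAction.separates_smul (hT : IsTreeAction H T) (h : H) {p q a b : V}
    (hs : Separates T p q a b) : Separates T (h • p) (h • q) (h • a) (h • b) :=
  fun _ hc => hs _ (hT.isCut_smul h (fun x y => by
    rw [Set.mem_singleton_iff, Set.mem_singleton_iff, smul_mk_eq_iff]) hc)

/-- An element fixing two vertices fixes the geodesic between them. -/
theorem IsTreeAction.support_fixed (hT : IsTreeAction H T) {h : H} {a b : V} (ha : h • a = a)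
    (hb : h • b = b) (w : T.Walk a b) (hw : w.IsPath) {x : V} (hx : x ∈ w.support) :
    h • x = x := by
  let φ : T →g T := ⟨fun v => h • v, fun hxy => hT.smul_adj h hxy⟩
  have hφ : Function.Injective φ := MulAction.injective h
  have hpath : ((w.map φ).copy ha hb).IsPath := by
    rw [SimpleGraph.Walk.isPath_copy]
    exact hw.map hφ
  have heq : (w.map φ).copy ha hb = w :=
    (hT.isTree.existsUnique_path a b).unique hpath hw
  have hs : w.support.map (fun v => h • v) = w.support := by
    have := congrArg SimpleGraph.Walk.support heq
    rwa [SimpleGraph.Walk.support_copy, SimpleGraph.Walk.support_map] at this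
  have := List.map_eq_map_iff.1 (hs.trans (List.map_id _).symm) x hx
  simpa using this

theorem IsTreeAction.fixed_of_separates (hT : IsTreeAction H T) {h : H} {p q a b : V}
    (ha : h • a = a) (hb : h • b = b) (hs : Separates T p q a b) : h • p = p ∧ h • q = q := by
  obtain ⟨w, hw, -⟩ := hT.isTree.existsUnique_path a b
  have := hs.mem_edges hT.isTree w
  exact ⟨hT.support_fixed ha hb w hw (w.fst_mem_support_of_mem_edges this),
    hT.support_fixed ha hb w hw (w.snd_mem_support_of_mem_edges this)⟩

/-- An element preserving an edge fixes both of its endpoints, as there are no inversions. -/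
theorem IsTreeAction.fixed_of_mk_eq (hT : IsTreeAction H T) {h : H} {x y : V} (hxy : T.Adj x y)
    (he : s(h • x, h • y) = s(x, y)) : h • x = x ∧ h • y = y := by
  rcases Sym2.eq_iff.1 he with he | he
  · exact he
  · exact absurd he (hT.no_inversion h hxy)

/-- For an `H`-invariant set of edges `D`, whether a cut along `D` distinguishes `v` from `h • v`
does not depend on `v`. -/
theorem IsTreeAction.isCut_translation (hT : IsTreeAction H T) (h : H) {D : Set (Sym2 V)}
    (hD : ∀ x y, s(h • x, h • y) ∈ D ↔ s(x, y) ∈ D) {c : V → ZMod 2} (hc : IsCut T D c)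
    (a b : V) : c (h • a) + c a = c (h • b) + c b :=
  eq_of_forall_adj_eq hT.isTree.connected.preconnected (f := fun v => c (h • v) + c v)
    (fun u v huv => ZMod.two_add_eq_add_of_ne_iff
      ((hT.isCut_smul h hD hc u v huv).trans (hc u v huv).symm)) a b

end CutsAction

/-! ### Trees with an action of a fixed group -/

/-- A simplicial tree with an action of `H` without inversion, bundled with its vertex set. -/
structure GTree (H : Type u) [Group H] where
  /-- The vertices of the tree. -/
  V : Type v
  [act : MulAction H V]
  /-- The underlying graph. -/
  graph : SimpleGraph V
  isTreeAction : IsTreeAction H graph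

attribute [instance] GTree.act

namespace GTree

variable {H : Type u} [Group H]

theorem isTree (T : GTree.{u, v} H) : T.graph.IsTree := T.isTreeAction.isTree

theorem preconnected (T : GTree.{u, v} H) : T.graph.Preconnected :=
  T.isTree.connected.preconnected

/-- An element of `N` fixing one vertex of `T` acts trivially on `T`. In other words, the vertex
stabilizers embed in `H / N`, up to the kernel of the action. -/
def IsReduced (N : Subgroup H) (T : GTree.{u, v} H) : Prop :=
  ∀ n ∈ N, ∀ v : T.V, n • v = v → ∀ w : T.V, n • w = w

/-- An equivariant map between trees that does not increase edge stabilizers modulo `N`: if the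
edge `pq` lies on the geodesic between the images of the endpoints of an edge `xy`, then the
stabilizer of `pq` is contained in `N` times the stabilizer of `xy`. (The stabilizer of `xy` is
always contained in the stabilizer of `pq`.) -/
structure IsFold (N : Subgroup H) {T R : GTree.{u, v} H} (f : T.V → R.V) : Prop where
  map_smul : ∀ (h : H) (x : T.V), f (h • x) = h • f x
  lift : ∀ {x y : T.V}, T.graph.Adj x y → ∀ {p q : R.V}, Separates R.graph p q (f x) (f y) →
    ∀ h : H, h • p = p → h • q = q → ∃ n ∈ N, (n * h) • x = x ∧ (n * h) • y = y

theorem IsFold.comp {N : Subgroup H} {T R R' : GTree.{u, v} H} {f' : R.V → R'.V}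
    {f : T.V → R.V} (hf' : IsFold N f') (hf : IsFold N f) : IsFold N (f' ∘ f) where
  map_smul h x := by rw [Function.comp_apply, hf.map_smul, hf'.map_smul, Function.comp_apply]
  lift {x y} hxy {p q} hpq h hp hq := by
    -- some edge `ab` on the geodesic from `f x` to `f y` is mapped across `pq`
    obtain ⟨c, hc⟩ := R'.isTree.exists_isCut {s(p, q)}
    obtain ⟨a, b, hab, hsep, hne⟩ := exists_separates_of_ne R.isTree (fun v => c (f' v))
      ((hc.separates_iff R'.preconnected _ _).1 hpq)
    obtain ⟨n, hn, ha, hb⟩ := hf'.lift hab ((hc.separates_iff R'.preconnected _ _).2 hne) h hp hq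
    obtain ⟨m, hm, hx, hy⟩ := hf.lift hxy hsep (n * h) ha hb
    exact ⟨m * n, N.mul_mem hm hn, by rwa [mul_assoc], by rwa [mul_assoc]⟩

theorem IsFold.smul_eq_of_eq {N : Subgroup H} {T R : GTree.{u, v} H} {f : T.V → R.V}
    (hf : IsFold N f) {g : H} {y z : T.V} (hg : g • y = z) (hyz : f y = f z) :
    g • f y = f y := by
  rw [← hf.map_smul, hg, hyz]

/-! ### Quotients of trees -/

/-- An `H`-invariant equivalence relation on the vertices of `T` whose quotient graph is again a
tree with an action without inversion. The field `cut` makes every edge of the quotient a bridge: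
the two-colouring `c` descends to the quotient and changes along that edge only. -/
structure IsTreeCongruence (T : GTree.{u, v} H) (r : Setoid T.V) : Prop where
  smul : ∀ (h : H) {x y : T.V}, r x y → r (h • x) (h • y)
  cut : ∀ {x y : T.V}, T.graph.Adj x y → ¬ r x y → ∃ c : T.V → ZMod 2,
    (∀ u v, r u v → c u = c v) ∧ c x ≠ c y ∧
      ∀ u v, T.graph.Adj u v → c u ≠ c v → r u x ∧ r v y ∨ r u y ∧ r v x
  no_inversion : ∀ (h : H) {x y : T.V}, T.graph.Adj x y → ¬ r x y → r (h • x) y → ¬ r (h • y) x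

/-- The quotient graph, without loops. -/
def quotGraph {V : Type*} (T : SimpleGraph V) (r : Setoid V) : SimpleGraph (Quotient r) where
  Adj a b := a ≠ b ∧ ∃ x y, T.Adj x y ∧ Quotient.mk r x = a ∧ Quotient.mk r y = b
  symm := ⟨fun _ _ ⟨hne, x, y, h, hx, hy⟩ => ⟨hne.symm, y, x, h.symm, hy, hx⟩⟩
  loopless := ⟨fun _ h => h.1 rfl⟩

theorem quotGraph_isTree {V : Type*} {T : SimpleGraph V} (hT : T.Connected) {r : Setoid V}
    (hr : ∀ {x y : V}, T.Adj x y → ¬ r x y → ∃ c : V → ZMod 2,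
      (∀ u v, r u v → c u = c v) ∧ c x ≠ c y ∧
        ∀ u v, T.Adj u v → c u ≠ c v → r u x ∧ r v y ∨ r u y ∧ r v x) :
    (quotGraph T r).IsTree := by
  have hne := hT.nonempty.map (Quotient.mk r)
  refine isTree_of_forall_adj_exists_cut ⟨fun a b => ?_⟩ ?_
  · induction a using Quotient.inductionOn with | h x
    induction b using Quotient.inductionOn with | h y
    obtain ⟨w⟩ := hT.preconnected x y
    induction w with
    | nil => exact SimpleGraph.Reachable.refl _
    | @cons x x' y h _ ih =>
      refine SimpleGraph.Reachable.trans ?_ ih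
      by_cases he : Quotient.mk r x = Quotient.mk r x'
      · rw [he]
      · exact SimpleGraph.Adj.reachable (G := quotGraph T r) ⟨he, x, x', h, rfl, rfl⟩
  · rintro a b ⟨hne, x, y, hxy, rfl, rfl⟩
    obtain ⟨c, hcr, hcxy, hc⟩ := hr hxy (fun h => hne (Quotient.sound h))
    refine ⟨Quotient.lift c hcr, hcxy, ?_⟩
    rintro a b ⟨-, u, v, huv, rfl, rfl⟩ hcuv
    rw [Sym2.eq_iff]
    rcases hc u v huv hcuv with ⟨h1, h2⟩ | ⟨h1, h2⟩
    · exact Or.inl ⟨Quotient.sound h1, Quotient.sound h2⟩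
    · exact Or.inr ⟨Quotient.sound h1, Quotient.sound h2⟩

/-- The action of `H` on the quotient by a congruence. -/
@[reducible]
def quotAction {T : GTree.{u, v} H} {r : Setoid T.V}
    (hr : ∀ (h : H) {x y : T.V}, r x y → r (h • x) (h • y)) : MulAction H (Quotient r) where
  smul h := Quotient.map (fun x => h • x) (fun _ _ hxy => hr h hxy)
  one_smul a := by
    induction a using Quotient.inductionOn with | h x
    exact congrArg (Quotient.mk r) (one_smul H x)
  mul_smul g h a := by
    induction a using Quotient.inductionOn with | h x
    exact congrArg (Quotient.mk r) (mul_smul g h x)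

/-- The quotient of a tree by a congruence. -/
def quot (T : GTree.{u, v} H) {r : Setoid T.V} (hr : IsTreeCongruence T r) : GTree.{u, v} H where
  V := Quotient r
  act := quotAction hr.smul
  graph := quotGraph T.graph r
  isTreeAction := by
    let _ := quotAction hr.smul
    refine ⟨quotGraph_isTree T.isTree.connected hr.cut, ?_, ?_⟩
    · rintro h a b ⟨hne, x, y, hxy, rfl, rfl⟩
      exact ⟨fun he => hne (MulAction.injective h he), h • x, h • y,
        T.isTreeAction.smul_adj h hxy, rfl, rfl⟩
    · rintro h a b ⟨hne, x, y, hxy, rfl, rfl⟩ ⟨h1, h2⟩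
      exact hr.no_inversion h hxy (fun h => hne (Quotient.sound h)) (Quotient.exact h1)
        (Quotient.exact h2)

/-- The quotient map. -/
def proj (T : GTree.{u, v} H) {r : Setoid T.V} (hr : IsTreeCongruence T r) (x : T.V) :
    (T.quot hr).V := Quotient.mk r x

section Quot

variable {T : GTree.{u, v} H} {r : Setoid T.V} (hr : IsTreeCongruence T r)

theorem proj_surjective : Function.Surjective (T.proj hr) := Quotient.mk_surjective

theorem proj_smul (h : H) (x : T.V) : T.proj hr (h • x) = h • T.proj hr x := rfl

theorem proj_eq_iff {x y : T.V} : T.proj hr x = T.proj hr y ↔ r x y := Quotient.eq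

theorem quot_adj {a b : (T.quot hr).V} (h : (T.quot hr).graph.Adj a b) :
    ∃ x y, T.graph.Adj x y ∧ ¬ r x y ∧ T.proj hr x = a ∧ T.proj hr y = b := by
  obtain ⟨hne, x, y, hxy, rfl, rfl⟩ := h
  exact ⟨x, y, hxy, fun h => hne (Quotient.sound h), rfl, rfl⟩

theorem adj_proj {x y : T.V} (h : T.graph.Adj x y) (hne : ¬ r x y) :
    (T.quot hr).graph.Adj (T.proj hr x) (T.proj hr y) :=
  ⟨fun he => hne (Quotient.exact he), x, y, h, rfl, rfl⟩

/-- The map induced on the quotient by a map compatible with the congruence. -/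
def quotLift {X : Type*} {f : T.V → X} (hf : ∀ x y, r x y → f x = f y) : (T.quot hr).V → X :=
  Quotient.lift f hf

theorem IsFold.quotLift {N : Subgroup H} {R : GTree.{u, v} H} {f : T.V → R.V} (h : IsFold N f)
    (hf : ∀ x y, r x y → f x = f y) : IsFold N (quotLift hr hf : (T.quot hr).V → R.V) where
  map_smul g a := by
    obtain ⟨x, rfl⟩ := proj_surjective hr a
    exact h.map_smul g x
  lift {a b} hab {p q} hpq g hp hq := by
    obtain ⟨x, y, hxy, -, rfl, rfl⟩ := quot_adj hr hab
    obtain ⟨n, hn, hx, hy⟩ := h.lift hxy hpq g hp hq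
    exact ⟨n, hn, by rw [← proj_smul, hx], by rw [← proj_smul, hy]⟩

theorem isFold_proj {N : Subgroup H}
    (hstab : ∀ {x y}, T.graph.Adj x y → ¬ r x y → ∀ h : H, r (h • x) x → r (h • y) y →
      ∃ n ∈ N, (n * h) • x = x ∧ (n * h) • y = y) : IsFold N (T.proj hr) where
  map_smul _ _ := rfl
  lift {x y} hxy {p q} hpq h hp hq := by
    have hne : ¬ r x y := fun h => hpq.ne (T.quot hr).isTree (Quotient.sound h)
    rcases Sym2.eq_iff.1 ((separates_iff_of_adj (T.quot hr).isTree (adj_proj hr hxy hne)).1 hpq)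
      with ⟨rfl, rfl⟩ | ⟨rfl, rfl⟩
    · exact hstab hxy hne h (Quotient.exact hp) (Quotient.exact hq)
    · exact hstab hxy hne h (Quotient.exact hq) (Quotient.exact hp)

end Quot

/-- The fibres of an equivariant map sending every edge to an edge or a vertex form a congruence,
with quotient the image of the map. -/
theorem isTreeCongruence_ker {T R : GTree.{u, v} H} {f : T.V → R.V}
    (hf : ∀ (h : H) (x : T.V), f (h • x) = h • f x)
    (hadj : ∀ {x y}, T.graph.Adj x y → f x ≠ f y → R.graph.Adj (f x) (f y)) :
    IsTreeCongruence T (Setoid.ker f) where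
  smul h x y hxy := by
    rw [Setoid.ker_def] at hxy ⊢
    rw [hf, hf, hxy]
  cut {x y} hxy hne := by
    rw [Setoid.ker_def] at hne
    obtain ⟨c, hc⟩ := R.isTree.exists_isCut {s(f x, f y)}
    refine ⟨fun v => c (f v), fun u v huv => congrArg c huv, (hc _ _ (hadj hxy hne)).2 rfl,
      fun u v huv hcuv => ?_⟩
    exact Sym2.eq_iff.1 ((hc _ _ (hadj huv fun h => hcuv (congrArg c h))).1 hcuv)
  no_inversion h x y hxy hne h1 h2 := by
    rw [Setoid.ker_def] at hne h1 h2
    rw [hf] at h1 h2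
    exact R.isTreeAction.no_inversion h (hadj hxy hne) ⟨h1, h2⟩

end GTree

/-! ### Merging two vertices -/

namespace GTree

variable {H : Type u} [Group H]

section Merge

variable (N : Subgroup H) (T : GTree.{u, v} H) (y z : T.V)

/-- The subgroup generated by the stabilizers of `y` and `z`: it stabilizes the class of `y` once
`y` and `z` are identified equivariantly. -/
def mergeStab : Subgroup H := MulAction.stabilizer H y ⊔ MulAction.stabilizer H z

/-- The subgroup generated by the elements of `N` that fix a vertex once `y` and `z` have been
identified equivariantly. -/
def mergeKernel : Subgroup H :=
  Subgroup.closure {n | n ∈ N ∧ ((∃ v : T.V, n • v = v) ∨ ∃ h, h⁻¹ * n * h ∈ mergeStab T y z)}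

/-- The `h`-translate of the class of `y` and `z`. -/
def mergeBlock (h : H) : Set T.V :=
  {v | ∃ d ∈ mergeStab T y z, v = (h * d) • y ∨ v = (h * d) • z}

variable {N T y z}

theorem mergeKernel_le : mergeKernel N T y z ≤ N :=
  (Subgroup.closure_le N).2 fun _ hn => hn.1

theorem mem_mergeKernel_of_fixed {n : H} (hn : n ∈ N) {v : T.V} (hv : n • v = v) :
    n ∈ mergeKernel N T y z :=
  Subgroup.subset_closure ⟨hn, Or.inl ⟨v, hv⟩⟩

theorem mem_mergeKernel_of_conj {n h : H} (hn : n ∈ N) (hh : h⁻¹ * n * h ∈ mergeStab T y z) :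
    n ∈ mergeKernel N T y z :=
  Subgroup.subset_closure ⟨hn, Or.inr ⟨h, hh⟩⟩

theorem mergeKernel_conj [hN : N.Normal] {k : H} (hk : k ∈ mergeKernel N T y z) (g : H) :
    g * k * g⁻¹ ∈ mergeKernel N T y z := by
  induction hk using Subgroup.closure_induction with
  | mem n hn =>
    obtain ⟨hn, ⟨v, hv⟩ | ⟨h, hh⟩⟩ := hn
    · refine mem_mergeKernel_of_fixed (hN.conj_mem n hn g) (v := g • v) ?_
      rw [smul_smul, inv_mul_cancel_right, mul_smul, hv]
    · refine mem_mergeKernel_of_conj (hN.conj_mem n hn g) (h := g * h) ?_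
      convert hh using 1
      group
  | one => simp
  | mul a b _ _ ha hb =>
    convert mul_mem ha hb using 1
    group
  | inv a _ ha =>
    convert inv_mem ha using 1
    group

theorem mem_mergeBlock_left (h : H) : h • y ∈ mergeBlock T y z h :=
  ⟨1, one_mem _, Or.inl (by rw [mul_one])⟩

theorem mem_mergeBlock_right (h : H) : h • z ∈ mergeBlock T y z h :=
  ⟨1, one_mem _, Or.inr (by rw [mul_one])⟩

theorem smul_mem_mergeBlock {h : H} {v : T.V} (hv : v ∈ mergeBlock T y z h) (g : H) :
    g • v ∈ mergeBlock T y z (g * h) := by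
  obtain ⟨d, hd, hv⟩ := hv
  refine ⟨d, hd, hv.imp ?_ ?_⟩ <;>
  · rintro rfl
    rw [smul_smul, mul_assoc]

/-- Two translates of the class of `y` and `z` meet only if they coincide. -/
theorem inv_mul_mem_mergeStab (hyz : ∀ g : H, g • y = z → g ∈ mergeStab T y z) {h h' g : H}
    {v : T.V} (hv : v ∈ mergeBlock T y z h) (hv' : g • v ∈ mergeBlock T y z h') :
    h'⁻¹ * g * h ∈ mergeStab T y z := by
  have hstab : ∀ a b : T.V, (a = y ∨ a = z) → (b = y ∨ b = z) → ∀ k : H, k • a = b →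
      k ∈ mergeStab T y z := by
    rintro a b (rfl | rfl) (rfl | rfl) k hk
    · exact Subgroup.mem_sup_left hk
    · exact hyz k hk
    · rw [← inv_mem_iff]
      exact hyz k⁻¹ (by rw [← hk, inv_smul_smul])
    · exact Subgroup.mem_sup_right hk
  obtain ⟨d, hd, hv⟩ := hv
  obtain ⟨d', hd', hv'⟩ := hv'
  obtain ⟨a, ha, rfl⟩ : ∃ a, (a = y ∨ a = z) ∧ v = (h * d) • a := by
    rcases hv with hv | hv
    · exact ⟨y, Or.inl rfl, hv⟩
    · exact ⟨z, Or.inr rfl, hv⟩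
  obtain ⟨b, hb, hab⟩ : ∃ b, (b = y ∨ b = z) ∧ g • (h * d) • a = (h' * d') • b := by
    rcases hv' with hv | hv
    · exact ⟨y, Or.inl rfl, hv⟩
    · exact ⟨z, Or.inr rfl, hv⟩
  have key : (h' * d')⁻¹ * g * (h * d) ∈ mergeStab T y z := by
    refine hstab a b ha hb _ ?_
    rw [mul_assoc, mul_smul, mul_smul, hab, inv_smul_smul]
  have := mul_mem (mul_mem hd' key) (inv_mem hd)
  convert this using 1
  group

theorem mergeBlock_subset {h h' : H} (hh : h'⁻¹ * h ∈ mergeStab T y z) :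
    mergeBlock T y z h ⊆ mergeBlock T y z h' := by
  rintro v ⟨d, hd, hv⟩
  exact ⟨h'⁻¹ * h * d, mul_mem hh hd, by simpa [mul_assoc] using hv⟩

variable (N T) in
/-- `v` and `w` are identified when `y` and `z` are merged equivariantly and `mergeKernel` is
divided out. -/
def MergeRel (y z v w : T.V) : Prop :=
  ∃ k ∈ mergeKernel N T y z, k • v = w ∨
    ∃ h, k • v ∈ mergeBlock T y z h ∧ w ∈ mergeBlock T y z h

theorem MergeRel.smul [N.Normal] {v w : T.V} (hvw : MergeRel N T y z v w) (h : H) :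
    MergeRel N T y z (h • v) (h • w) := by
  obtain ⟨k, hk, hvw⟩ := hvw
  have hconj : (h * k * h⁻¹) • h • v = h • k • v := by
    rw [smul_smul, smul_smul, inv_mul_cancel_right]
  refine ⟨h * k * h⁻¹, mergeKernel_conj hk h, ?_⟩
  rw [hconj]
  rcases hvw with rfl | ⟨g, hv, hw⟩
  · exact Or.inl rfl
  · exact Or.inr ⟨h * g, smul_mem_mergeBlock hv h, smul_mem_mergeBlock hw h⟩

variable (N) in
/-- The relation `MergeRel` as a setoid. -/
def mergeSetoid (hyz : ∀ g : H, g • y = z → g ∈ mergeStab T y z) : Setoid T.V where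
  r := MergeRel N T y z
  iseqv := by
    refine ⟨fun v => ⟨1, one_mem _, Or.inl (one_smul _ _)⟩, ?_, ?_⟩
    · rintro v w ⟨k, hk, rfl | ⟨h, hv, hw⟩⟩
      · exact ⟨k⁻¹, inv_mem hk, Or.inl (inv_smul_smul _ _)⟩
      · refine ⟨k⁻¹, inv_mem hk, Or.inr ⟨k⁻¹ * h, smul_mem_mergeBlock hw _, ?_⟩⟩
        simpa using smul_mem_mergeBlock hv k⁻¹
    · rintro u v w ⟨k, hk, huv⟩ ⟨l, hl, hvw⟩
      refine ⟨l * k, mul_mem hl hk, ?_⟩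
      rw [mul_smul]
      rcases huv with rfl | ⟨h, hu, hv⟩
      · exact hvw
      · rcases hvw with rfl | ⟨h', hv', hw'⟩
        · exact Or.inr ⟨l * h, smul_mem_mergeBlock hu l, smul_mem_mergeBlock hv l⟩
        · refine Or.inr ⟨h', mergeBlock_subset ?_ (smul_mem_mergeBlock hu l), hw'⟩
          have := inv_mul_mem_mergeStab hyz hv hv'
          rwa [mul_assoc] at this

theorem mergeRel_pair (g : H) : MergeRel N T y z (g • y) (g • z) :=
  ⟨1, one_mem _, Or.inr ⟨g, by rw [one_smul]; exact mem_mergeBlock_left g,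
    mem_mergeBlock_right g⟩⟩

theorem mergeRel_of_mem {k : H} (hk : k ∈ mergeKernel N T y z) (v : T.V) :
    MergeRel N T y z v (k • v) :=
  ⟨k, hk, Or.inl rfl⟩

/-- The class of `y` is connected: a function taking the same value at `g • y` and `g • z` for
all `g` is constant on it. -/
theorem apply_smul_mergeStab {X : Type*} {c : T.V → X} (hpair : ∀ g : H, c (g • y) = c (g • z))
    {d : H} (hd : d ∈ mergeStab T y z) (h : H) : c ((h * d) • y) = c (h • y) := by
  let S : Subgroup H :=
    { carrier := {d | ∀ h : H, c ((h * d) • y) = c (h • y)}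
      one_mem' := fun h => by rw [mul_one]
      mul_mem' := fun {a b} ha hb h => by rw [← mul_assoc, hb, ha]
      inv_mem' := fun {a} ha h => by rw [← ha (h * a⁻¹), inv_mul_cancel_right] }
  have hle : mergeStab T y z ≤ S := by
    refine sup_le (fun a ha h => ?_) (fun a ha h => ?_)
    · rw [mul_smul, MulAction.mem_stabilizer_iff.1 ha]
    · rw [hpair, mul_smul, MulAction.mem_stabilizer_iff.1 ha, hpair]
  exact hle hd h

/-- A function invariant under `mergeKernel` and taking the same value at `g • y` and `g • z` for
all `g` is compatible with the merging relation. -/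
theorem MergeRel.apply_eq {X : Type*} {c : T.V → X} (hpair : ∀ g : H, c (g • y) = c (g • z))
    (hker : ∀ k ∈ mergeKernel N T y z, ∀ v, c (k • v) = c v) {v w : T.V}
    (h : MergeRel N T y z v w) : c v = c w := by
  obtain ⟨k, hk, rfl | ⟨h, hv, hw⟩⟩ := h
  · exact (hker k hk v).symm
  · rw [← hker k hk v]
    have key : ∀ v ∈ mergeBlock T y z h, c v = c (h • y) := by
      rintro v ⟨d, hd, rfl | rfl⟩
      · exact apply_smul_mergeStab hpair hd h
      · rw [← hpair, apply_smul_mergeStab hpair hd h]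
    rw [key _ hv, key _ hw]

/-- A cut along a set of edges invariant under `mergeKernel` that does not separate `g • y` from
`g • z`, for any `g`, is compatible with the merging relation. -/
theorem MergeRel.isCut_eq {E : Set (Sym2 T.V)}
    (hE : ∀ k ∈ mergeKernel N T y z, ∀ a b, s(k • a, k • b) ∈ E ↔ s(a, b) ∈ E) {c : T.V → ZMod 2}
    (hc : IsCut T.graph E c) (hpair : ∀ g : H, c (g • y) = c (g • z)) {v w : T.V}
    (h : MergeRel N T y z v w) : c v = c w := by
  refine h.apply_eq hpair fun k hk => ?_
  induction hk using Subgroup.closure_induction with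
  | mem n hn =>
    intro v
    have htrans := T.isTreeAction.isCut_translation n (hE n (Subgroup.subset_closure hn)) hc
    have haux : ∀ {a b d : ZMod 2}, a + b = d + d → a = b := by decide
    obtain ⟨-, ⟨w, hw⟩ | ⟨g, hg⟩⟩ := hn
    · exact haux (d := c w) ((htrans v w).trans (by rw [hw]))
    · refine haux (d := c (g • y)) ((htrans v (g • y)).trans ?_)
      have := apply_smul_mergeStab hpair hg g
      rw [← mul_assoc, mul_inv_cancel_left, mul_smul] at this
      rw [this]
  | one => exact fun v => by rw [one_smul]
  | mul a b _ _ ha hb => exact fun v => by rw [mul_smul, ha, hb]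
  | inv a _ ha => exact fun v => by rw [← ha (a⁻¹ • v), smul_inv_smul]

section Congruence

theorem MergeRel.symm' {v w : T.V} (h : MergeRel N T y z v w)
    (hyz : ∀ g : H, g • y = z → g ∈ mergeStab T y z) : MergeRel N T y z w v :=
  (mergeSetoid N hyz).symm' h

theorem MergeRel.trans' {u v w : T.V} (h : MergeRel N T y z u v) (h' : MergeRel N T y z v w)
    (hyz : ∀ g : H, g • y = z → g ∈ mergeStab T y z) : MergeRel N T y z u w :=
  (mergeSetoid N hyz).trans' h h'

/-- Every edge of the quotient by the merging relation is a bridge. -/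
theorem mergeRel_cut (hyz : ∀ g : H, g • y = z → g ∈ mergeStab T y z)
    (hadj : y = z ∨ T.graph.Adj y z ∨ ∃ x, T.graph.Adj x y ∧ T.graph.Adj x z)
    {a b : T.V} (hab : T.graph.Adj a b) (hne : ¬ MergeRel N T y z a b) :
    ∃ c : T.V → ZMod 2, (∀ u v, MergeRel N T y z u v → c u = c v) ∧ c a ≠ c b ∧
      ∀ u v, T.graph.Adj u v → c u ≠ c v → MergeRel N T y z u a ∧ MergeRel N T y z v b ∨
        MergeRel N T y z u b ∧ MergeRel N T y z v a := by
  let P : T.V → T.V → Prop := fun u v => MergeRel N T y z u a ∧ MergeRel N T y z v b ∨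
    MergeRel N T y z u b ∧ MergeRel N T y z v a
  let E : Set (Sym2 T.V) := {e | ∃ u v, e = s(u, v) ∧ P u v}
  have hP : ∀ {u v u' v'}, P u v → MergeRel N T y z u u' → MergeRel N T y z v v' → P u' v' := by
    intro u v u' v' h hu hv
    have hu := hu.symm' hyz
    have hv := hv.symm' hyz
    exact h.imp (fun h => ⟨hu.trans' h.1 hyz, hv.trans' h.2 hyz⟩)
      (fun h => ⟨hu.trans' h.1 hyz, hv.trans' h.2 hyz⟩)
  have hE : ∀ u v, s(u, v) ∈ E ↔ P u v := by
    refine fun u v => ⟨?_, fun h => ⟨u, v, rfl, h⟩⟩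
    rintro ⟨u', v', he, h⟩
    rcases Sym2.eq_iff.1 he with ⟨rfl, rfl⟩ | ⟨rfl, rfl⟩
    · exact h
    · exact h.symm.imp And.symm And.symm
  have hrefl : ∀ v, MergeRel N T y z v v := (mergeSetoid N hyz).refl'
  obtain ⟨c, hc⟩ := T.isTree.exists_isCut E
  refine ⟨c, fun u v huv => huv.isCut_eq (E := E) ?_ hc ?_, ?_, ?_⟩
  · intro k hk u v
    rw [hE, hE]
    exact ⟨fun h => hP h ((mergeRel_of_mem hk u).symm' hyz) ((mergeRel_of_mem hk v).symm' hyz),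
      fun h => hP h (mergeRel_of_mem hk u) (mergeRel_of_mem hk v)⟩
  · intro g
    rcases hadj with rfl | h | ⟨x, hxy, hxz⟩
    · rfl
    · by_contra hcne
      have := (hE _ _).1 ((hc _ _ (T.isTreeAction.smul_adj g h)).1 hcne)
      refine hne ?_
      have hg : MergeRel N T y z (g • y) (g • z) := mergeRel_pair g
      rcases this with ⟨h1, h2⟩ | ⟨h1, h2⟩
      · exact ((h1.symm' hyz).trans' hg hyz).trans' h2 hyz
      · exact ((h2.symm' hyz).trans' (hg.symm' hyz) hyz).trans' h1 hyz
    · have h1 := hc _ _ (T.isTreeAction.smul_adj g hxy)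
      have h2 := hc _ _ (T.isTreeAction.smul_adj g hxz)
      rw [hE] at h1 h2
      have h12 : P (g • x) (g • y) ↔ P (g • x) (g • z) :=
        ⟨fun h => hP h (hrefl _) (mergeRel_pair g),
          fun h => hP h (hrefl _) ((mergeRel_pair g).symm' hyz)⟩
      have haux : ∀ {a b d : ZMod 2}, (a ≠ b ↔ a ≠ d) → b = d := by decide
      exact haux ((h1.trans h12).trans h2.symm)
  · exact (hc _ _ hab).2 ((hE _ _).2 (Or.inl ⟨hrefl _, hrefl _⟩))
  · exact fun u v huv hcuv => (hE _ _).1 ((hc _ _ huv).1 hcuv)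

/-- If `y = z` or `yz` is an edge, every edge that survives in the quotient has, up to
`mergeKernel`, a unique preimage. -/
theorem mergeRel_stab [N.Normal] (hyz : ∀ g : H, g • y = z → g ∈ mergeStab T y z)
    (hadj : y = z ∨ T.graph.Adj y z)
    {a b : T.V} (hab : T.graph.Adj a b) (hne : ¬ MergeRel N T y z a b) {h : H}
    (hh : MergeRel N T y z (h • a) a ∧ MergeRel N T y z (h • b) b ∨
      MergeRel N T y z (h • a) b ∧ MergeRel N T y z (h • b) a) :
    ∃ k ∈ mergeKernel N T y z, (k * h) • a = a ∧ (k * h) • b = b := by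
  let E : Set (Sym2 T.V) := {e | ∃ k ∈ mergeKernel N T y z, e = s(k • a, k • b)}
  obtain ⟨c, hc⟩ := T.isTree.exists_isCut E
  have hcr : ∀ {u v}, MergeRel N T y z u v → c u = c v := by
    intro u v huv
    refine huv.isCut_eq (E := E) ?_ hc ?_
    · intro k hk u v
      constructor
      · rintro ⟨l, hl, he⟩
        refine ⟨k⁻¹ * l, mul_mem (inv_mem hk) hl, ?_⟩
        rwa [← smul_mk_eq_iff k, smul_smul, smul_smul, mul_inv_cancel_left]
      · rintro ⟨l, hl, he⟩
        refine ⟨k * l, mul_mem hk hl, ?_⟩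
        rwa [mul_smul, mul_smul, smul_mk_eq_iff]
    · intro g
      rcases hadj with rfl | h
      · rfl
      · by_contra hcne
        obtain ⟨k, hk, he⟩ := (hc _ _ (T.isTreeAction.smul_adj g h)).1 hcne
        refine hne ?_
        have hg : MergeRel N T y z (g • y) (g • z) := mergeRel_pair g
        have ha := mergeRel_of_mem hk a
        have hb := (mergeRel_of_mem hk b).symm' hyz
        rcases Sym2.eq_iff.1 he with ⟨h1, h2⟩ | ⟨h1, h2⟩
        · rw [h1, h2] at hg
          exact (ha.trans' hg hyz).trans' hb hyz
        · rw [h1, h2] at hg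
          exact (ha.trans' (hg.symm' hyz) hyz).trans' hb hyz
  have hcab : c a ≠ c b := (hc _ _ hab).2 ⟨1, one_mem _, by rw [one_smul, one_smul]⟩
  have hchab : c (h • a) ≠ c (h • b) := by
    rcases hh with ⟨h1, h2⟩ | ⟨h1, h2⟩
    · rwa [hcr h1, hcr h2]
    · rw [hcr h1, hcr h2]
      exact hcab.symm
  obtain ⟨k, hk, he⟩ := (hc _ _ (T.isTreeAction.smul_adj h hab)).1 hchab
  refine ⟨k⁻¹, inv_mem hk, T.isTreeAction.fixed_of_mk_eq hab ?_⟩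
  rwa [← smul_mk_eq_iff k, smul_smul, smul_smul, mul_inv_cancel_left]

/-- Merging two equal or adjacent vertices. -/
theorem isTreeCongruence_merge_of_adj [N.Normal] (hyz : ∀ g : H, g • y = z → g ∈ mergeStab T y z)
    (hadj : y = z ∨ T.graph.Adj y z) : IsTreeCongruence T (mergeSetoid N hyz) where
  smul h _ _ hvw := MergeRel.smul hvw h
  cut hab hne := mergeRel_cut hyz (hadj.imp id Or.inl) hab hne
  no_inversion h a b hab hne h1 h2 := by
    obtain ⟨k, hk, ha, -⟩ := mergeRel_stab hyz hadj hab hne (Or.inr ⟨h1, h2⟩)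
    refine hne (MergeRel.trans' (MergeRel.symm' ?_ hyz) h1 hyz)
    have := mergeRel_of_mem hk (h • a)
    rwa [smul_smul, ha] at this

/-- Merging two vertices with a common neighbour, when the quotient has a map without collapsed
edges to another tree. -/
theorem isTreeCongruence_merge_of_common [N.Normal]
    (hyz : ∀ g : H, g • y = z → g ∈ mergeStab T y z)
    (hadj : ∃ x, T.graph.Adj x y ∧ T.graph.Adj x z) {R : GTree.{u, v} H} {f : T.V → R.V}
    (hf : ∀ (h : H) (x : T.V), f (h • x) = h • f x)
    (hfr : ∀ v w, MergeRel N T y z v w → f v = f w)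
    (hfadj : ∀ v w, T.graph.Adj v w → R.graph.Adj (f v) (f w)) :
    IsTreeCongruence T (mergeSetoid N hyz) where
  smul h _ _ hvw := MergeRel.smul hvw h
  cut hab hne := mergeRel_cut hyz (Or.inr (Or.inr hadj)) hab hne
  no_inversion h a b hab _ h1 h2 := by
    have h1 := hfr _ _ h1
    have h2 := hfr _ _ h2
    rw [hf] at h1 h2
    exact R.isTreeAction.no_inversion h (hfadj a b hab) ⟨h1, h2⟩

/-- The quotient by the merging relation is reduced. -/
theorem isReduced_merge [N.Normal] (hyz : ∀ g : H, g • y = z → g ∈ mergeStab T y z)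
    (hr : IsTreeCongruence T (mergeSetoid N hyz)) : IsReduced N (T.quot hr) := by
  intro n hn a ha b
  obtain ⟨v, rfl⟩ := proj_surjective hr a
  obtain ⟨w, rfl⟩ := proj_surjective hr b
  rw [← proj_smul, proj_eq_iff] at ha ⊢
  obtain ⟨k, hk, hkv⟩ := ha
  rw [smul_smul] at hkv
  have hkn : k * n ∈ mergeKernel N T y z := by
    have hkn := N.mul_mem (mergeKernel_le hk) hn
    rcases hkv with hkv | ⟨h, h1, h2⟩
    · exact mem_mergeKernel_of_fixed hkn hkv
    · exact mem_mergeKernel_of_conj hkn (inv_mul_mem_mergeStab hyz h2 h1)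
  have : n ∈ mergeKernel N T y z := by simpa using mul_mem (inv_mem hk) hkn
  exact (mergeRel_of_mem this w).symm' hyz

/-- A map to a reduced tree identifying `y` and `z` factors through the merging relation. -/
theorem MergeRel.map_eq [N.Normal] {R : GTree.{u, v} H} (hR : IsReduced N R) {f : T.V → R.V}
    (hf : ∀ (h : H) (x : T.V), f (h • x) = h • f x) (hfyz : f y = f z) {v w : T.V}
    (h : MergeRel N T y z v w) : f v = f w := by
  have hpair : ∀ g : H, f (g • y) = f (g • z) := fun g => by rw [hf, hf, hfyz]
  refine h.apply_eq hpair fun k hk => ?_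
  induction hk using Subgroup.closure_induction with
  | mem n hn =>
    intro v
    rw [hf]
    obtain ⟨hn, ⟨w, hw⟩ | ⟨g, hg⟩⟩ := hn
    · exact hR n hn (f w) (by rw [← hf, hw]) _
    · refine hR n hn (f (g • y)) ?_ _
      have := apply_smul_mergeStab hpair hg g
      rwa [← mul_assoc, mul_inv_cancel_left, mul_smul, hf] at this
  | one => exact fun v => by rw [one_smul]
  | mul a b _ _ ha hb => exact fun v => by rw [mul_smul, ha, hb]
  | inv a _ ha => exact fun v => by rw [← ha (a⁻¹ • v), smul_inv_smul]

/-- Dividing out the elements of `N` that fix a vertex produces a reduced tree, and every map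
from `T` to a reduced tree induces a map from it. -/
theorem exists_reduction (N : Subgroup H) [N.Normal] (T : GTree.{u, v} H) :
    ∃ (R : GTree.{u, v} H) (π : T.V → R.V), IsReduced N R ∧ IsFold N π ∧ Function.Surjective π ∧
      (∀ a b, R.graph.Adj a b → ∃ x y, T.graph.Adj x y ∧ π x = a ∧ π y = b) ∧
      (∀ (h : H) (v : T.V), h • π v = π v → ∃ n ∈ N, (n * h) • v = v) ∧
      ∀ (R' : GTree.{u, v} H) (f : T.V → R'.V), IsReduced N R' → IsFold N f →
        ∃ f' : R.V → R'.V, IsFold N f' := by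
  obtain ⟨y⟩ := T.isTree.connected.nonempty
  have hyy : ∀ g : H, g • y = y → g ∈ mergeStab T y y := fun g hg => Subgroup.mem_sup_left hg
  have hr := isTreeCongruence_merge_of_adj (N := N) hyy (Or.inl rfl)
  refine ⟨T.quot hr, T.proj hr, isReduced_merge hyy hr, isFold_proj hr ?_, proj_surjective hr, ?_,
    ?_, ?_⟩
  · intro a b hab hne h ha hb
    obtain ⟨k, hk, h⟩ := mergeRel_stab hyy (Or.inl rfl) hab hne (Or.inl ⟨ha, hb⟩)
    exact ⟨k, mergeKernel_le hk, h⟩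
  · intro a b hab
    obtain ⟨x, y, hxy, -, hx, hy⟩ := quot_adj hr hab
    exact ⟨x, y, hxy, hx, hy⟩
  · intro h v hv
    rw [← proj_smul, proj_eq_iff] at hv
    obtain ⟨k, hk, hkv⟩ := hv
    refine ⟨k, mergeKernel_le hk, ?_⟩
    rw [mul_smul]
    rcases hkv with hkv | ⟨g, h1, h2⟩
    · exact hkv
    · have hblock : ∀ v ∈ mergeBlock T y y g, v = g • y := by
        rintro v ⟨d, hd, hv⟩
        rw [mergeStab, sup_idem, MulAction.mem_stabilizer_iff] at hd
        rwa [or_self, mul_smul, hd] at hv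
      rw [hblock _ h1, ← hblock _ h2]
  · intro R' f hR' hf
    exact ⟨_, hf.quotLift hr fun _ _ h => MergeRel.map_eq hR' hf.map_smul rfl h⟩

end Congruence

end Merge

end GTree

/-! ### Barycentric subdivision -/

namespace GTree

variable {H : Type u} [Group H]

/-- The action on the edges of a tree. -/
instance edgeAction (T : GTree.{u, v} H) : MulAction H T.graph.edgeSet where
  smul h e := ⟨e.1.map (fun x => h • x), by
    obtain ⟨e, he⟩ := e
    induction e with | h x y
    exact T.isTreeAction.smul_adj h he⟩
  one_smul e := by
    obtain ⟨e, he⟩ := e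
    induction e with | h x y
    exact Subtype.ext (congrArg₂ (fun a b => s(a, b)) (one_smul H x) (one_smul H y))
  mul_smul g h e := by
    obtain ⟨e, he⟩ := e
    induction e with | h x y
    exact Subtype.ext (congrArg₂ (fun a b => s(a, b)) (mul_smul g h x) (mul_smul g h y))

/-- The edge with endpoints `x` and `y`. -/
def edge (T : GTree.{u, v} H) {x y : T.V} (h : T.graph.Adj x y) : T.graph.edgeSet := ⟨s(x, y), h⟩

theorem smul_edge {T : GTree.{u, v} H} (g : H) {x y : T.V} (h : T.graph.Adj x y) :
    g • T.edge h = T.edge (T.isTreeAction.smul_adj g h) := rfl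

theorem exists_eq_edge {T : GTree.{u, v} H} (e : T.graph.edgeSet) :
    ∃ (x y : T.V) (h : T.graph.Adj x y), e = T.edge h := by
  obtain ⟨e, he⟩ := e
  induction e with | h x y
  exact ⟨x, y, he, rfl⟩

theorem smul_edge_eq_iff {T : GTree.{u, v} H} (g : H) {x y : T.V} (h : T.graph.Adj x y) :
    g • T.edge h = T.edge h ↔ g • x = x ∧ g • y = y := by
  constructor
  · exact fun he => T.isTreeAction.fixed_of_mk_eq h (congrArg Subtype.val he)
  · rintro ⟨hx, hy⟩
    exact Subtype.ext (congrArg₂ (fun a b => s(a, b)) hx hy)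

/-- The barycentric subdivision of a graph: the new vertices are the edges, each of which is
joined to its two endpoints. -/
def subdivGraph {V : Type*} (T : SimpleGraph V) : SimpleGraph (V ⊕ T.edgeSet) where
  Adj a b := match a, b with
    | .inl x, .inr e => x ∈ e.1
    | .inr e, .inl x => x ∈ e.1
    | _, _ => False
  symm := ⟨by rintro (x | e) (y | e') h <;> exact h⟩
  loopless := ⟨by rintro (x | e) h <;> exact h⟩

theorem subdivGraph_isTree {V : Type*} {T : SimpleGraph V} (hT : T.IsTree) :
    (subdivGraph T).IsTree := by
  classical
  have hadj : ∀ {x y : V} (h : T.Adj x y),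
      (subdivGraph T).Adj (.inl x) (.inr ⟨s(x, y), h⟩) := fun {x y} h => Sym2.mem_mk_left x y
  have hinl : ∀ x y, (subdivGraph T).Reachable (.inl x) (.inl y) := by
    intro x y
    obtain ⟨w⟩ := hT.connected.preconnected x y
    induction w with
    | nil => exact SimpleGraph.Reachable.refl _
    | @cons x x' y h _ ih =>
      have h' : (subdivGraph T).Adj (.inr ⟨s(x, x'), h⟩) (.inl x') := Sym2.mem_mk_right x x'
      exact ((hadj h).reachable.trans h'.reachable).trans ih
  have hinr : ∀ e, ∃ x, (subdivGraph T).Reachable (.inr e) (.inl x) := by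
    rintro ⟨e, he⟩
    induction e with | h x y
    exact ⟨x, (hadj he).reachable.symm⟩
  have hne : Nonempty (V ⊕ T.edgeSet) := hT.connected.nonempty.map Sum.inl
  refine isTree_of_forall_adj_exists_cut ⟨?_⟩ ?_
  · have : ∀ a, ∃ x, (subdivGraph T).Reachable a (.inl x) := by
      rintro (x | e)
      · exact ⟨x, SimpleGraph.Reachable.refl _⟩
      · exact hinr e
    intro a b
    obtain ⟨x, hx⟩ := this a
    obtain ⟨y, hy⟩ := this b
    exact (hx.trans (hinl x y)).trans hy.symm
  · have key : ∀ (x : V) (e : T.edgeSet), x ∈ e.1 → ∃ c : V ⊕ T.edgeSet → ZMod 2,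
        c (.inl x) ≠ c (.inr e) ∧ ∀ (v : V) (e' : T.edgeSet), v ∈ e'.1 →
          c (.inl v) ≠ c (.inr e') → v = x ∧ e' = e := by
      rintro x ⟨e, he⟩ hx
      obtain ⟨y, rfl⟩ := hx
      obtain ⟨c, hc⟩ := hT.exists_isCut {s(x, y)}
      have hxy := (hc x y he).2 rfl
      -- the midpoint of the cut edge is put on the side of `y`, every other one on the side of
      -- the two endpoints of its edge
      refine ⟨Sum.elim c fun e' => if e'.1 = s(x, y) then c y else c e'.1.out.1, by simpa, ?_⟩
      rintro v ⟨e', he'⟩ hv hne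
      by_cases hee : e' = s(x, y)
      · subst hee
        rw [Sum.elim_inl, Sum.elim_inr, if_pos rfl] at hne
        rcases Sym2.mem_iff.1 hv with rfl | rfl
        · exact ⟨rfl, rfl⟩
        · exact absurd rfl hne
      · rw [Sum.elim_inl, Sum.elim_inr, if_neg hee] at hne
        refine absurd ?_ hne
        obtain ⟨w, rfl⟩ := hv
        have hvw : c v = c w := by
          by_contra hne'
          exact hee ((hc v w he').1 hne')
        rcases Sym2.mem_iff.1 (Sym2.out_fst_mem s(v, w)) with h | h
        · exact congrArg c h.symm
        · exact hvw.trans (congrArg c h.symm)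
    rintro (x | e) (y | e') hab
    · exact hab.elim
    · obtain ⟨c, hcne, hc⟩ := key x e' hab
      refine ⟨c, hcne, ?_⟩
      rintro (u | d) (v | d') huv hne
      · exact huv.elim
      · obtain ⟨rfl, rfl⟩ := hc u d' huv hne
        rfl
      · obtain ⟨rfl, rfl⟩ := hc v d huv hne.symm
        exact Sym2.eq_swap
      · exact huv.elim
    · obtain ⟨c, hcne, hc⟩ := key y e hab
      refine ⟨c, hcne.symm, ?_⟩
      rintro (u | d) (v | d') huv hne
      · exact huv.elim
      · obtain ⟨rfl, rfl⟩ := hc u d' huv hne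
        exact Sym2.eq_swap
      · obtain ⟨rfl, rfl⟩ := hc v d huv hne.symm
        rfl
      · exact huv.elim
    · exact hab.elim

/-- The action on the vertices of the barycentric subdivision. -/
instance subdivAction (T : GTree.{u, v} H) : MulAction H (T.V ⊕ T.graph.edgeSet) where
  smul h := Sum.map (fun x => h • x) (fun e => h • e)
  one_smul := by
    rintro (x | e)
    · exact congrArg Sum.inl (one_smul H x)
    · exact congrArg Sum.inr (one_smul H e)
  mul_smul g h := by
    rintro (x | e)
    · exact congrArg Sum.inl (mul_smul g h x)
    · exact congrArg Sum.inr (mul_smul g h e)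

/-- The barycentric subdivision of a tree with an action of `H`. -/
def subdiv (T : GTree.{u, v} H) : GTree.{u, v} H where
  V := T.V ⊕ T.graph.edgeSet
  graph := subdivGraph T.graph
  isTreeAction := by
    have hmem : ∀ (h : H) (x : T.V) (e : T.graph.edgeSet), x ∈ e.1 → h • x ∈ (h • e).1 :=
      fun h x e hx => Sym2.mem_map.2 ⟨x, hx, rfl⟩
    refine ⟨subdivGraph_isTree T.isTree, ?_, ?_⟩
    · rintro h (x | e) (y | e') hab
      · exact hab
      · exact hmem h x e' hab
      · exact hmem h y e hab
      · exact hab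
    · rintro h (x | e) (y | e') hab ⟨h1, h2⟩
      · exact hab
      · exact Sum.inl_ne_inr h1
      · exact Sum.inl_ne_inr h2
      · exact hab

/-- The old vertices of the subdivision. -/
def oldVertex (T : GTree.{u, v} H) (x : T.V) : T.subdiv.V := Sum.inl x

/-- The new vertices of the subdivision. -/
def midpoint (T : GTree.{u, v} H) (e : T.graph.edgeSet) : T.subdiv.V := Sum.inr e

variable {T : GTree.{u, v} H}

theorem subdiv_cases (a : T.subdiv.V) : (∃ x, a = T.oldVertex x) ∨ ∃ e, a = T.midpoint e := by
  rcases a with x | e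
  · exact Or.inl ⟨x, rfl⟩
  · exact Or.inr ⟨e, rfl⟩

theorem smul_oldVertex (h : H) (x : T.V) : h • T.oldVertex x = T.oldVertex (h • x) := rfl

theorem smul_midpoint (h : H) (e : T.graph.edgeSet) : h • T.midpoint e = T.midpoint (h • e) := rfl

theorem oldVertex_injective : Function.Injective T.oldVertex := Sum.inl_injective

theorem midpoint_injective : Function.Injective T.midpoint := Sum.inr_injective

theorem smul_midpoint_edge_eq_iff (g : H) {x y : T.V} (h : T.graph.Adj x y) :
    g • T.midpoint (T.edge h) = T.midpoint (T.edge h) ↔ g • x = x ∧ g • y = y := by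
  rw [smul_midpoint, midpoint_injective.eq_iff, smul_edge_eq_iff]

theorem subdiv_adj {a b : T.subdiv.V} (h : T.subdiv.graph.Adj a b) :
    ∃ (x y : T.V) (hxy : T.graph.Adj x y), a = T.oldVertex x ∧ b = T.midpoint (T.edge hxy) ∨
      a = T.midpoint (T.edge hxy) ∧ b = T.oldVertex x := by
  have key : ∀ (x : T.V) (e : T.graph.edgeSet), x ∈ e.1 →
      ∃ (y : T.V) (hxy : T.graph.Adj x y), e = T.edge hxy := by
    rintro x ⟨e, he⟩ ⟨y, rfl⟩
    exact ⟨y, he, rfl⟩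
  rcases a with x | e <;> rcases b with y | e'
  · exact h.elim
  · obtain ⟨z, hz, rfl⟩ := key x e' h
    exact ⟨x, z, hz, Or.inl ⟨rfl, rfl⟩⟩
  · obtain ⟨z, hz, rfl⟩ := key y e h
    exact ⟨y, z, hz, Or.inr ⟨rfl, rfl⟩⟩
  · exact h.elim

/-- There is a walk of length at most `n` from `a` to `b`. -/
def WalkLE {V : Type*} (T : SimpleGraph V) (n : ℕ) (a b : V) : Prop :=
  ∃ w : T.Walk a b, w.length ≤ n

theorem WalkLE.symm {V : Type*} {T : SimpleGraph V} {n : ℕ} {a b : V} (h : WalkLE T n a b) :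
    WalkLE T n b a := by
  obtain ⟨w, hw⟩ := h
  exact ⟨w.reverse, by rwa [SimpleGraph.Walk.length_reverse]⟩

theorem WalkLE.mono {V : Type*} {T : SimpleGraph V} {m n : ℕ} {a b : V} (h : WalkLE T m a b)
    (hmn : m ≤ n) : WalkLE T n a b := by
  obtain ⟨w, hw⟩ := h
  exact ⟨w, hw.trans hmn⟩

theorem WalkLE.smul {n : ℕ} {a b : T.V} (h : WalkLE T.graph n a b) (g : H) :
    WalkLE T.graph n (g • a) (g • b) := by
  obtain ⟨w, hw⟩ := h
  let φ : T.graph →g T.graph := ⟨fun v => g • v, fun hxy => T.isTreeAction.smul_adj g hxy⟩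
  exact ⟨w.map φ, by rwa [SimpleGraph.Walk.length_map]⟩

/-- A point on the geodesic from `a` to `b`, one step away from `a` unless `a = b`. -/
theorem exists_step (R : GTree.{u, v} H) {n : ℕ} {a b : R.V} (h : WalkLE R.graph (n + 1) a b) :
    ∃ m, WalkLE R.graph 1 a m ∧ WalkLE R.graph n m b ∧
      (∀ p q, Separates R.graph p q a m ∨ Separates R.graph p q m b → Separates R.graph p q a b) ∧
      ∀ g : H, g • a = a → g • b = b → g • m = m := by
  classical
  obtain ⟨w, hw⟩ := h
  have hlen := (w.length_bypass_le_length).trans hw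
  have hpath := w.bypass_isPath
  generalize w.bypass = w' at hlen hpath
  cases w' with
  | nil =>
    refine ⟨a, ⟨.nil, by simp⟩, ⟨.nil, by simp⟩, fun p q h => ?_, fun g h _ => h⟩
    rcases h with h | h <;> exact h
  | @cons _ m _ hadj w' =>
    refine ⟨m, ⟨.cons hadj .nil, by simp⟩, ⟨w', by simpa using hlen⟩, ?_, ?_⟩
    · rintro p q (h | h)
      · refine separates_of_mem_edges _ hpath ?_
        have := h.mem_edges R.isTree (.cons hadj .nil)
        rw [SimpleGraph.Walk.edges_cons] at this ⊢
        rcases List.mem_cons.1 this with h | h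
        · exact List.mem_cons.2 (Or.inl h)
        · simp at h
      · refine separates_of_mem_edges _ hpath ?_
        rw [SimpleGraph.Walk.edges_cons]
        exact List.mem_cons_of_mem _ (h.mem_edges R.isTree w')
    · exact fun g ha hb => R.isTreeAction.support_fixed ha hb _ hpath (by simp)

/-- A choice of one point for each edge can be made equivariantly. -/
theorem exists_equivariant_edge_map {X : Type*} [MulAction H X] (P : T.graph.edgeSet → X → Prop)
    (hP : ∀ (h : H) e x, P e x → P (h • e) (h • x))
    (hex : ∀ e, ∃ x, P e x ∧ ∀ h : H, h • e = e → h • x = x) :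
    ∃ m : T.graph.edgeSet → X, (∀ (h : H) e, m (h • e) = h • m e) ∧ ∀ e, P e (m e) := by
  choose m₀ hm₀ hfix using hex
  let rep : T.graph.edgeSet → T.graph.edgeSet := fun e =>
    (Quotient.mk (MulAction.orbitRel H T.graph.edgeSet) e).out
  have hrep : ∀ e, ∃ h : H, h • rep e = e := fun e =>
    MulAction.orbitRel_apply.1 ((MulAction.orbitRel H T.graph.edgeSet).symm' (Quotient.mk_out e))
  have hrep' : ∀ (h : H) e, rep (h • e) = rep e := fun h e =>
    congrArg Quotient.out (Quotient.sound (MulAction.orbitRel_apply.2 ⟨h, rfl⟩))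
  choose k hk using hrep
  refine ⟨fun e => k e • m₀ (rep e), fun h e => ?_, fun e => ?_⟩
  · change k (h • e) • m₀ (rep (h • e)) = h • k e • m₀ (rep e)
    have h1 := hk (h • e)
    rw [hrep'] at h1 ⊢
    have h2 : ((h * k e)⁻¹ * k (h • e)) • rep e = rep e := by
      rw [mul_smul, h1, inv_smul_eq_iff, mul_smul, hk]
    have h3 := hfix _ _ h2
    rwa [mul_smul, inv_smul_eq_iff, mul_smul] at h3
  · have := hP (k e) _ _ (hm₀ (rep e))
    rwa [hk] at this

/-- A fold whose edges have images of length at most `n + 1` extends to the barycentric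
subdivision, where the images of edges have length at most `max 1 n`. -/
theorem IsFold.exists_subdiv {N : Subgroup H} {R : GTree.{u, v} H} {f : T.V → R.V}
    (hf : IsFold N f) {n : ℕ}
    (hn : ∀ x y, T.graph.Adj x y → WalkLE R.graph (n + 1) (f x) (f y)) :
    ∃ f' : T.subdiv.V → R.V, IsFold N f' ∧
      ∀ a b, T.subdiv.graph.Adj a b → WalkLE R.graph (max 1 n) (f' a) (f' b) := by
  obtain ⟨m, hm, hmP⟩ := exists_equivariant_edge_map (T := T) (X := R.V)
    (fun e m => ∀ x y (h : T.graph.Adj x y), e = T.edge h →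
      WalkLE R.graph (max 1 n) (f x) m ∧ ∀ p q, Separates R.graph p q (f x) m →
        Separates R.graph p q (f x) (f y))
    (by
      intro h e m hP x y hxy he
      have hxy' : T.graph.Adj (h⁻¹ • x) (h⁻¹ • y) := T.isTreeAction.smul_adj h⁻¹ hxy
      obtain ⟨h1, h2⟩ := hP _ _ hxy' (by
        rw [← inv_smul_smul h e, he, smul_edge])
      rw [hf.map_smul] at h1 h2
      refine ⟨by simpa using h1.smul h, fun p q hpq => ?_⟩
      have := h2 (h⁻¹ • p) (h⁻¹ • q) (by simpa using R.isTreeAction.separates_smul h⁻¹ hpq)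
      rw [hf.map_smul] at this
      simpa using R.isTreeAction.separates_smul h this)
    (by
      intro e
      obtain ⟨x, y, hxy, rfl⟩ := exists_eq_edge e
      obtain ⟨m, h1, h2, h3, h4⟩ := R.exists_step (hn x y hxy)
      refine ⟨m, ?_, fun h he => ?_⟩
      · intro a b hab he
        rcases Sym2.eq_iff.1 (congrArg Subtype.val he) with ⟨rfl, rfl⟩ | ⟨rfl, rfl⟩
        · exact ⟨h1.mono (le_max_left _ _), fun p q hpq => h3 p q (Or.inl hpq)⟩
        · exact ⟨h2.symm.mono (le_max_right _ _),
            fun p q hpq => (h3 p q (Or.inr hpq.symm)).symm⟩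
      · rw [smul_edge_eq_iff] at he
        exact h4 h (by rw [← hf.map_smul, he.1]) (by rw [← hf.map_smul, he.2]))
  let f' : T.subdiv.V → R.V := Sum.elim f m
  have hold : ∀ x, f' (T.oldVertex x) = f x := fun _ => rfl
  have hmid : ∀ e, f' (T.midpoint e) = m e := fun _ => rfl
  refine ⟨f', ⟨?_, ?_⟩, ?_⟩
  · intro h a
    rcases subdiv_cases a with ⟨x, rfl⟩ | ⟨e, rfl⟩
    · rw [smul_oldVertex, hold, hold, hf.map_smul]
    · rw [smul_midpoint, hmid, hmid, hm]
  · intro a b hab p q hpq h hp hq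
    obtain ⟨x, y, hxy, ⟨rfl, rfl⟩ | ⟨rfl, rfl⟩⟩ := subdiv_adj hab
    · rw [hold, hmid] at hpq
      obtain ⟨k, hk, h1, h2⟩ := hf.lift hxy ((hmP _ x y hxy rfl).2 p q hpq) h hp hq
      exact ⟨k, hk, by rw [smul_oldVertex, h1], (smul_midpoint_edge_eq_iff _ hxy).2 ⟨h1, h2⟩⟩
    · rw [hold, hmid] at hpq
      obtain ⟨k, hk, h1, h2⟩ := hf.lift hxy ((hmP _ x y hxy rfl).2 p q hpq.symm) h hp hq
      exact ⟨k, hk, (smul_midpoint_edge_eq_iff _ hxy).2 ⟨h1, h2⟩, by rw [smul_oldVertex, h1]⟩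
  · intro a b hab
    obtain ⟨x, y, hxy, ⟨rfl, rfl⟩ | ⟨rfl, rfl⟩⟩ := subdiv_adj hab
    · exact (hmP _ x y hxy rfl).1
    · exact (hmP _ x y hxy rfl).1.symm

end GTree

/-! ### Cocompact trees -/

namespace GTree

variable {H : Type u} [Group H]

/-- The action on the tree has finitely many orbits of vertices and of edges. -/
structure IsCofinite (T : GTree.{u, v} H) : Prop where
  vertices : Finite (MulAction.orbitRel.Quotient H T.V)
  edges : ∃ s : Set (T.V × T.V), s.Finite ∧
    ∀ x y, T.graph.Adj x y → ∃ h : H, (h • x, h • y) ∈ s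

/-- The map induced on orbits by an equivariant map. -/
def orbitMap {T R : GTree.{u, v} H} (f : T.V → R.V) (hf : ∀ (h : H) (x : T.V), f (h • x) = h • f x) :
    MulAction.orbitRel.Quotient H T.V → MulAction.orbitRel.Quotient H R.V :=
  Quotient.map f (by
    rintro _ b ⟨h, rfl⟩
    exact ⟨h, (hf h b).symm⟩)

/-- The orbit of a vertex. -/
def orbitMk (T : GTree.{u, v} H) (x : T.V) : MulAction.orbitRel.Quotient H T.V :=
  Quotient.mk _ x

theorem orbitMk_eq_iff {T : GTree.{u, v} H} {x y : T.V} :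
    T.orbitMk x = T.orbitMk y ↔ ∃ h : H, h • y = x :=
  Quotient.eq.trans MulAction.orbitRel_apply

theorem orbitMk_surjective (T : GTree.{u, v} H) : Function.Surjective T.orbitMk :=
  Quotient.mk_surjective

theorem orbitMap_mk {T R : GTree.{u, v} H} (f : T.V → R.V)
    (hf : ∀ (h : H) (x : T.V), f (h • x) = h • f x) (x : T.V) :
    orbitMap f hf (T.orbitMk x) = R.orbitMk (f x) := rfl

theorem orbitMap_surjective {T R : GTree.{u, v} H} {f : T.V → R.V}
    (hf : ∀ (h : H) (x : T.V), f (h • x) = h • f x) (hs : Function.Surjective f) :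
    Function.Surjective (orbitMap f hf) := by
  intro o
  obtain ⟨a, rfl⟩ := R.orbitMk_surjective o
  obtain ⟨x, rfl⟩ := hs a
  exact ⟨T.orbitMk x, rfl⟩

theorem IsCofinite.quot {T : GTree.{u, v} H} (hT : IsCofinite T) {r : Setoid T.V}
    (hr : IsTreeCongruence T r) : IsCofinite (T.quot hr) where
  vertices := by
    have := hT.vertices
    exact Finite.of_surjective _ (orbitMap_surjective (R := T.quot hr) (proj_smul hr)
      (proj_surjective hr))
  edges := by
    obtain ⟨s, hs, h⟩ := hT.edges
    refine ⟨Prod.map (T.proj hr) (T.proj hr) '' s, hs.image _, fun a b hab => ?_⟩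
    obtain ⟨x, y, hxy, -, rfl, rfl⟩ := quot_adj hr hab
    obtain ⟨g, hg⟩ := h x y hxy
    exact ⟨g, _, hg, rfl⟩

theorem IsCofinite.subdiv {T : GTree.{u, v} H} (hT : IsCofinite T) : IsCofinite T.subdiv := by
  classical
  obtain ⟨s, hs, h⟩ := hT.edges
  -- the midpoint of a pair of vertices, or an irrelevant vertex if they are not adjacent
  let μ : T.V × T.V → T.subdiv.V := fun p =>
    if h : T.graph.Adj p.1 p.2 then T.midpoint (T.edge h) else T.oldVertex p.1
  have hμ : ∀ {x y} (hxy : T.graph.Adj x y), μ (x, y) = T.midpoint (T.edge hxy) := fun hxy =>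
    dif_pos hxy
  refine ⟨?_, ?_⟩
  · have hfin : (T.subdiv.orbitMk '' (μ '' s) ∪
        Set.range (orbitMap (R := T.subdiv) T.oldVertex (fun _ _ => rfl))).Finite := by
      have := hT.vertices
      exact ((hs.image _).image _).union (Set.finite_range _)
    refine Set.finite_univ_iff.1 (hfin.subset fun o _ => ?_)
    obtain ⟨a, rfl⟩ := T.subdiv.orbitMk_surjective o
    rcases subdiv_cases a with ⟨x, rfl⟩ | ⟨e, rfl⟩
    · exact Or.inr ⟨T.orbitMk x, rfl⟩
    · obtain ⟨x, y, hxy, rfl⟩ := exists_eq_edge e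
      obtain ⟨g, hg⟩ := h x y hxy
      refine Or.inl ⟨_, ⟨_, hg, rfl⟩, orbitMk_eq_iff.2 ⟨g, ?_⟩⟩
      rw [hμ (T.isTreeAction.smul_adj g hxy)]
      rfl
  · refine ⟨(fun p => (T.oldVertex p.1, μ p)) '' s ∪ (fun p => (μ p, T.oldVertex p.1)) '' s,
      (hs.image _).union (hs.image _), fun a b hab => ?_⟩
    obtain ⟨x, y, hxy, ⟨rfl, rfl⟩ | ⟨rfl, rfl⟩⟩ := subdiv_adj hab
    · obtain ⟨g, hg⟩ := h x y hxy
      exact ⟨g, Or.inl ⟨_, hg, Prod.ext rfl (hμ (T.isTreeAction.smul_adj g hxy))⟩⟩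
    · obtain ⟨g, hg⟩ := h x y hxy
      exact ⟨g, Or.inr ⟨_, hg, Prod.ext (hμ (T.isTreeAction.smul_adj g hxy)) rfl⟩⟩

/-- A finitely generated group acting on a tree preserves a cofinite subtree: the union of the
translates of finitely many geodesics joining a base point to its images under generators. -/
theorem exists_cofinite_subtree [Group.FG H] (N : Subgroup H) (R : GTree.{u, v} H)
    (hR : IsReduced N R) :
    ∃ (T : GTree.{u, v} H) (f : T.V → R.V), IsCofinite T ∧ IsReduced N T ∧ IsFold N f := by
  classical
  obtain ⟨S, hS, hSfin⟩ := (Group.fg_iff (G := H)).1 inferInstance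
  obtain ⟨x₀⟩ := R.isTree.connected.nonempty
  let p : ∀ s : H, R.graph.Walk x₀ (s • x₀) := fun s => (R.preconnected x₀ (s • x₀)).some
  -- the oriented edges of the subtree
  let E : R.V → R.V → Prop := fun a b => ∃ (h : H), ∃ s ∈ S, ∃ a' b',
    s(a', b') ∈ (p s).edges ∧ a = h • a' ∧ b = h • b'
  have hEsymm : ∀ {a b}, E a b → E b a := by
    rintro a b ⟨h, s, hs, a', b', he, rfl, rfl⟩
    exact ⟨h, s, hs, b', a', by rwa [Sym2.eq_swap], rfl, rfl⟩
  have hEsmul : ∀ (g : H) {a b}, E a b → E (g • a) (g • b) := by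
    rintro g a b ⟨h, s, hs, a', b', he, rfl, rfl⟩
    exact ⟨g * h, s, hs, a', b', he, by rw [mul_smul], by rw [mul_smul]⟩
  have hEadj : ∀ {a b}, E a b → R.graph.Adj a b := by
    rintro a b ⟨h, s, hs, a', b', he, rfl, rfl⟩
    exact R.isTreeAction.smul_adj h ((p s).adj_of_mem_edges he)
  let U : SubMulAction H R.V :=
    { carrier := {v | (∃ h : H, v = h • x₀) ∨ ∃ w, E v w}
      smul_mem' := by
        rintro g v (⟨h, rfl⟩ | ⟨w, hw⟩)
        · exact Or.inl ⟨g * h, by rw [mul_smul]⟩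
        · exact Or.inr ⟨_, hEsmul g hw⟩ }
  let Γ : SimpleGraph U :=
    { Adj := fun a b => E a b
      symm := ⟨fun _ _ h => hEsymm h⟩
      loopless := ⟨fun a h => (hEadj h).ne rfl⟩ }
  have hΓsmul : ∀ (g : H) {a b : U}, Γ.Adj a b → Γ.Adj (g • a) (g • b) := fun g _ _ h =>
    hEsmul g h
  have hreach_smul : ∀ (g : H) {a b : U}, Γ.Reachable a b → Γ.Reachable (g • a) (g • b) := by
    rintro g a b ⟨w⟩
    exact ⟨w.map (⟨fun v => g • v, fun h => hΓsmul g h⟩ : Γ →g Γ)⟩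
  have hwalk : ∀ {a b : R.V} (w : R.graph.Walk a b), (∀ c d, s(c, d) ∈ w.edges → E c d) →
      ∀ v ∈ w.support, ∀ (ha : a ∈ U) (hv : v ∈ U), Γ.Reachable ⟨a, ha⟩ ⟨v, hv⟩ := by
    intro a b w
    induction w with
    | nil =>
      intro _ v hv ha hv'
      rw [SimpleGraph.Walk.support_nil, List.mem_singleton] at hv
      subst hv
      exact SimpleGraph.Reachable.refl _
    | @cons a a' b h w ih =>
      intro hE v hv ha hv'
      rw [SimpleGraph.Walk.support_cons, List.mem_cons] at hv
      rcases hv with rfl | hv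
      · exact SimpleGraph.Reachable.refl _
      · have haa : E a a' := hE a a' (by simp)
        have ha' : a' ∈ U := Or.inr ⟨a, hEsymm haa⟩
        have hadj : Γ.Adj ⟨a, ha⟩ ⟨a', ha'⟩ := haa
        exact hadj.reachable.trans (ih (fun c d hcd => hE c d (by simp [hcd])) v hv ha' hv')
  let u₀ : U := ⟨x₀, Or.inl ⟨1, (one_smul _ _).symm⟩⟩
  have hgeo : ∀ s ∈ S, ∀ v ∈ (p s).support, ∀ hv : v ∈ U, Γ.Reachable u₀ ⟨v, hv⟩ :=
    fun s hs v hv hv' => hwalk (p s) (fun c d hcd => ⟨1, s, hs, c, d, hcd,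
      (one_smul _ _).symm, (one_smul _ _).symm⟩) v hv _ hv'
  have horbit : ∀ h : H, Γ.Reachable u₀ (h • u₀) := by
    let K : Subgroup H :=
      { carrier := {h | Γ.Reachable u₀ (h • u₀)}
        one_mem' := by
          rw [Set.mem_ofPred_eq, one_smul]
        mul_mem' := fun {a b} ha hb => by
          rw [Set.mem_ofPred_eq] at *
          rw [mul_smul]
          exact SimpleGraph.Reachable.trans ha (hreach_smul a hb)
        inv_mem' := fun {a} ha => by
          have := hreach_smul a⁻¹ ha
          rw [inv_smul_smul] at this
          exact this.symm }
    have hle : Subgroup.closure S ≤ K := by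
      refine (Subgroup.closure_le K).2 fun s hs => ?_
      exact hgeo s hs _ (p s).end_mem_support (s • u₀).2
    intro h
    exact hle (by rw [hS]; trivial)
  have hconn : Γ.Connected := by
    have : Nonempty U := ⟨u₀⟩
    have hbase : ∀ a : U, Γ.Reachable u₀ a := by
      rintro ⟨v, ⟨h, rfl⟩ | ⟨w, hw⟩⟩
      · exact horbit h
      · obtain ⟨h, s, hs, a', b', he, rfl, rfl⟩ := hw
        have ha' : a' ∈ U := Or.inr ⟨b', 1, s, hs, a', b', he, (one_smul _ _).symm,
          (one_smul _ _).symm⟩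
        have := hgeo s hs a' ((p s).fst_mem_support_of_mem_edges he) ha'
        exact (horbit h).trans (hreach_smul h this)
    exact ⟨fun a b => (hbase a).symm.trans (hbase b)⟩
  let ι : Γ →g R.graph := ⟨fun a => a.1, fun h => hEadj h⟩
  let T : GTree.{u, v} H :=
    { V := U
      graph := Γ
      isTreeAction :=
        { isTree := ⟨hconn, R.isTree.isAcyclic.comap ι Subtype.val_injective⟩
          smul_adj := fun g _ _ h => hΓsmul g h
          no_inversion := fun g a b hab ⟨h1, h2⟩ => R.isTreeAction.no_inversion g (hEadj hab)
            ⟨congrArg Subtype.val h1, congrArg Subtype.val h2⟩ } }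
  refine ⟨T, fun a : U => a.1, ⟨?_, ?_⟩, ?_, ⟨fun _ _ => rfl, ?_⟩⟩
  · -- every vertex is a translate of `x₀` or of a vertex of one of the chosen geodesics
    let F : Set R.V := {x₀} ∪ ⋃ s ∈ S, {v | v ∈ (p s).support}
    have hF : F.Finite := (Set.finite_singleton x₀).union
      (hSfin.biUnion fun s _ => List.finite_toSet (p s).support)
    have hfin : (T.orbitMk '' ((fun a : U => a.1) ⁻¹' F)).Finite :=
      (hF.preimage Subtype.val_injective.injOn).image _
    refine Set.finite_univ_iff.1 (hfin.subset fun o _ => ?_)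
    obtain ⟨⟨v, hv⟩, rfl⟩ := T.orbitMk_surjective o
    rcases id hv with ⟨h, rfl⟩ | ⟨w, h, s, hs, a', b', he, rfl, rfl⟩
    · exact ⟨u₀, Or.inl rfl, orbitMk_eq_iff.2 ⟨h⁻¹, Subtype.ext (inv_smul_smul _ _)⟩⟩
    · have ha' : a' ∈ U := Or.inr ⟨b', 1, s, hs, a', b', he, (one_smul _ _).symm,
          (one_smul _ _).symm⟩
      refine ⟨⟨a', ha'⟩, Or.inr ?_, orbitMk_eq_iff.2 ⟨h⁻¹, Subtype.ext (inv_smul_smul _ _)⟩⟩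
      exact Set.mem_biUnion hs ((p s).fst_mem_support_of_mem_edges he)
  · let F : Set (R.V × R.V) := ⋃ s ∈ S, {v | v.1 ∈ (p s).support ∧ v.2 ∈ (p s).support}
    have hF : F.Finite := hSfin.biUnion fun s _ =>
      (List.finite_toSet (p s).support).prod (List.finite_toSet (p s).support)
    refine ⟨(Prod.map (fun a : U => a.1) (fun a : U => a.1)) ⁻¹' F, hF.preimage
      (Function.Injective.prodMap Subtype.val_injective Subtype.val_injective).injOn, ?_⟩
    rintro ⟨a, ha⟩ ⟨b, hb⟩ hab
    obtain ⟨h, s, hs, a', b', he, h1, h2⟩ := hab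
    refine ⟨h⁻¹, Set.mem_biUnion hs ⟨?_, ?_⟩⟩
    · have : h⁻¹ • a = a' := by rw [inv_smul_eq_iff]; exact h1
      change h⁻¹ • a ∈ _
      rw [this]
      exact (p s).fst_mem_support_of_mem_edges he
    · have : h⁻¹ • b = b' := by rw [inv_smul_eq_iff]; exact h2
      change h⁻¹ • b ∈ _
      rw [this]
      exact (p s).snd_mem_support_of_mem_edges he
  · exact fun n hn v hv w => Subtype.ext (hR n hn v.1 (congrArg Subtype.val hv) w.1)
  · intro a b hab x y hxy h hx hy
    refine ⟨1, N.one_mem, ?_⟩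
    rw [one_mul]
    rcases Sym2.eq_iff.1 ((separates_iff_of_adj R.isTree (hEadj hab)).1 hxy) with
      ⟨rfl, rfl⟩ | ⟨rfl, rfl⟩
    · exact ⟨Subtype.ext hx, Subtype.ext hy⟩
    · exact ⟨Subtype.ext hy, Subtype.ext hx⟩

end GTree

/-! ### The complexity of a tree -/

namespace GTree

variable {H : Type u} [Group H]

/-- The homomorphisms `H → ℤ/2` that vanish on all vertex stabilizers of `T`. They can be seen as
the mod 2 cohomology classes of degree 1 of the quotient graph. -/
def ellipticHoms (T : GTree.{u, v} H) : Set (H →* Multiplicative (ZMod 2)) :=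
  {χ | ∀ (h : H) (v : T.V), h • v = v → χ h = 1}

/-- The vertex `v` is a branch vertex if its stabilizer does not fix all its neighbours. In the
quotient graph of groups, this means that the group of `v` is larger than the group of one of the
edges starting at `v`. -/
def IsBranch (T : GTree.{u, v} H) (v : T.V) : Prop :=
  ∃ u, T.graph.Adj v u ∧ ∃ h : H, h • v = v ∧ h • u ≠ u

/-- The orbits of branch vertices. -/
def branchOrbits (T : GTree.{u, v} H) : Set (MulAction.orbitRel.Quotient H T.V) :=
  T.orbitMk '' {v | T.IsBranch v}

/-- The complexity of a tree: the number of homomorphisms `H → ℤ/2` vanishing on vertex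
stabilizers, then the number of orbits of branch vertices. -/
noncomputable def complexity (T : GTree.{u, v} H) : ℕ ×ₗ ℕ :=
  toLex (T.ellipticHoms.ncard, T.branchOrbits.ncard)

theorem finite_monoidHom [Group.FG H] {A : Type*} [Group A] [Finite A] : Finite (H →* A) := by
  obtain ⟨S, hS, hSfin⟩ := (Group.fg_iff (G := H)).1 inferInstance
  have := hSfin.to_subtype
  refine Finite.of_injective (fun (χ : H →* A) (s : S) => χ s) fun χ χ' h => ?_
  exact MonoidHom.eq_of_eqOn_dense hS fun s hs => congrFun h ⟨s, hs⟩

theorem IsBranch.smul {T : GTree.{u, v} H} {v : T.V} (hv : T.IsBranch v) (g : H) :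
    T.IsBranch (g • v) := by
  obtain ⟨u, huv, h, h1, h2⟩ := hv
  refine ⟨g • u, T.isTreeAction.smul_adj g huv, g * h * g⁻¹, ?_, fun h3 => h2 ?_⟩
  · rw [mul_smul, inv_smul_smul, mul_smul, h1]
  · rwa [mul_smul, inv_smul_smul, mul_smul, smul_left_cancel_iff] at h3

theorem smul_eq_of_not_isBranch {T : GTree.{u, v} H} {v u : T.V} (hv : ¬ T.IsBranch v)
    (huv : T.graph.Adj v u) {h : H} (h1 : h • v = v) : h • u = u := by
  by_contra h2
  exact hv ⟨u, huv, h, h1, h2⟩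

/-- The parity of the number of edges of an invariant set of edges `D` crossed by the geodesic
from `v` to `h • v` is a homomorphism in `h` that vanishes on vertex stabilizers. -/
theorem exists_parity_hom (T : GTree.{u, v} H) {D : Set (Sym2 T.V)}
    (hD : ∀ (h : H) x y, s(h • x, h • y) ∈ D ↔ s(x, y) ∈ D) {c : T.V → ZMod 2}
    (hc : IsCut T.graph D c) :
    ∃ χ ∈ T.ellipticHoms, ∀ (h : H) (v : T.V), c (h • v) ≠ c v → χ h ≠ 1 := by
  obtain ⟨v₀⟩ := T.isTree.connected.nonempty
  have htrans : ∀ (h : H) (v : T.V), c (h • v) + c v = c (h • v₀) + c v₀ := fun h v =>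
    T.isTreeAction.isCut_translation h (hD h) hc v v₀
  have haux : ∀ a b d : ZMod 2, a + d = (a + b) + (b + d) := by decide
  have haux' : ∀ a : ZMod 2, a + a = 0 := by decide
  have haux'' : ∀ a b : ZMod 2, a ≠ b → a + b ≠ 0 := by decide
  refine ⟨⟨⟨fun h => Multiplicative.ofAdd (c (h • v₀) + c v₀), ?_⟩, ?_⟩, ?_, ?_⟩
  · rw [one_smul, haux', ofAdd_zero]
  · intro g h
    change Multiplicative.ofAdd _ = Multiplicative.ofAdd _ * Multiplicative.ofAdd _
    rw [← ofAdd_add, ← htrans g (h • v₀), mul_smul]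
    exact congrArg _ (haux _ _ _)
  · intro h v hv
    change Multiplicative.ofAdd (c (h • v₀) + c v₀) = 1
    rw [← htrans h v, hv, haux', ofAdd_zero]
  · intro h v hv
    change Multiplicative.ofAdd (c (h • v₀) + c v₀) ≠ 1
    rw [← htrans h v]
    exact fun h => haux'' _ _ hv (ofAdd_eq_one.1 h)

/-! ### Trees of minimal complexity -/

section Minimal

variable {N : Subgroup H} {R : ℕ → GTree.{u, v} H}

variable (N R) in
/-- The reduced cofinite trees that map to one of the trees `R j`. -/
structure IsAdmissible (T : GTree.{u, v} H) : Prop where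
  isReduced : IsReduced N T
  isCofinite : IsCofinite T
  exists_isFold : ∃ (j : ℕ) (f : T.V → (R j).V), IsFold N f

variable (N R) in
/-- The admissible trees of minimal complexity. -/
structure IsMinimal (T : GTree.{u, v} H) : Prop where
  isAdmissible : IsAdmissible N R T
  le : ∀ T', IsAdmissible N R T' → T.complexity ≤ T'.complexity

theorem exists_isMinimal {T : GTree.{u, v} H} (hT : IsAdmissible N R T) :
    ∃ T', IsMinimal N R T' := by
  obtain ⟨T', hT', hmin⟩ := (InvImage.wf (complexity (H := H)) wellFounded_lt).has_min
    {T | IsAdmissible N R T} ⟨T, hT⟩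
  exact ⟨T', hT', fun T'' hT'' => not_lt.1 (hmin T'' hT'')⟩

theorem IsMinimal.ellipticHoms_eq [Group.FG H] {T T' : GTree.{u, v} H} (hT : IsMinimal N R T)
    (hT' : IsAdmissible N R T') (hsub : T'.ellipticHoms ⊆ T.ellipticHoms) :
    T'.ellipticHoms = T.ellipticHoms := by
  have : Finite (H →* Multiplicative (ZMod 2)) := finite_monoidHom
  refine Set.eq_of_subset_of_ncard_le hsub ?_ (Set.toFinite _)
  rcases Prod.Lex.toLex_le_toLex.1 (hT.le T' hT') with h | h
  · exact h.le
  · exact h.1.le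

theorem IsMinimal.branchOrbits_le [Group.FG H] {T T' : GTree.{u, v} H} (hT : IsMinimal N R T)
    (hT' : IsAdmissible N R T') (hsub : T'.ellipticHoms ⊆ T.ellipticHoms) :
    T.branchOrbits.ncard ≤ T'.branchOrbits.ncard := by
  rcases Prod.Lex.toLex_le_toLex.1 (hT.le T' hT') with h | h
  · exact absurd h (by rw [hT.ellipticHoms_eq hT' hsub]; exact lt_irrefl _)
  · exact h.2

theorem IsMinimal.of_le {T T' : GTree.{u, v} H} [Group.FG H] (hT : IsMinimal N R T)
    (hT' : IsAdmissible N R T') (hsub : T'.ellipticHoms ⊆ T.ellipticHoms)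
    (hle : T'.branchOrbits.ncard ≤ T.branchOrbits.ncard) : IsMinimal N R T' := by
  refine ⟨hT', fun T'' hT'' => le_trans ?_ (hT.le T'' hT'')⟩
  exact Prod.Lex.toLex_le_toLex.2 (Or.inr ⟨by rw [hT.ellipticHoms_eq hT' hsub], hle⟩)

/-- Subdividing does not increase the complexity: midpoints are not branch vertices. -/
theorem IsMinimal.subdiv [Group.FG H] {T : GTree.{u, v} H} (hT : IsMinimal N R T) {j : ℕ}
    {f : T.subdiv.V → (R j).V} (hf : IsFold N f) : IsMinimal N R T.subdiv := by
  have hfin := hT.isAdmissible.isCofinite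
  refine hT.of_le ⟨?_, hfin.subdiv, j, f, hf⟩ ?_ ?_
  · intro n hn a ha b
    have htriv : ∀ w : T.V, n • w = w := by
      rcases subdiv_cases a with ⟨x, rfl⟩ | ⟨e, rfl⟩
      · exact hT.isAdmissible.isReduced n hn x (oldVertex_injective ha)
      · obtain ⟨x, y, hxy, rfl⟩ := exists_eq_edge e
        exact hT.isAdmissible.isReduced n hn x ((smul_midpoint_edge_eq_iff n hxy).1 ha).1
    rcases subdiv_cases b with ⟨x, rfl⟩ | ⟨e, rfl⟩
    · rw [smul_oldVertex, htriv]
    · obtain ⟨x, y, hxy, rfl⟩ := exists_eq_edge e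
      exact (smul_midpoint_edge_eq_iff n hxy).2 ⟨htriv x, htriv y⟩
  · exact fun χ hχ h v hv => hχ h (T.oldVertex v) (by rw [smul_oldVertex, hv])
  · have := hfin.vertices
    have hsub : T.subdiv.branchOrbits ⊆
        orbitMap (R := T.subdiv) T.oldVertex (fun _ _ => rfl) '' T.branchOrbits := by
      rintro _ ⟨a, ⟨b, hab, h, ha, hb⟩, rfl⟩
      obtain ⟨x, y, hxy, ⟨rfl, rfl⟩ | ⟨rfl, rfl⟩⟩ := subdiv_adj hab
      · have hx := oldVertex_injective ha
        refine ⟨_, ⟨x, ⟨y, hxy, h, hx, fun hy => hb ?_⟩, rfl⟩, rfl⟩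
        exact (smul_midpoint_edge_eq_iff h hxy).2 ⟨hx, hy⟩
      · refine absurd ?_ hb
        rw [smul_oldVertex, ((smul_midpoint_edge_eq_iff h hxy).1 ha).1]
    exact (Set.ncard_le_ncard hsub (Set.toFinite _)).trans (Set.ncard_image_le (Set.toFinite _))

/-- A map sends every edge to an edge or to a vertex. -/
def IsSimplicial {T R : GTree.{u, v} H} (f : T.V → R.V) : Prop :=
  ∀ x y, T.graph.Adj x y → f x ≠ f y → R.graph.Adj (f x) (f y)

/-- If `T` has minimal complexity and maps simplicially to `R j`, then a homomorphism to `ℤ/2`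
vanishing on the vertex stabilizers of `T` also vanishes on those of the image of `T`: otherwise
the image would have smaller complexity. -/
theorem IsMinimal.apply_eq_one [Group.FG H] (hR : ∀ j, IsReduced N (R j)) {T : GTree.{u, v} H}
    (hT : IsMinimal N R T) {j : ℕ} {f : T.V → (R j).V} (hf : IsFold N f) (hfs : IsSimplicial f)
    {χ : H →* Multiplicative (ZMod 2)} (hχ : χ ∈ T.ellipticHoms) {h : H} {x : T.V}
    (hx : h • f x = f x) : χ h = 1 := by
  have hr := isTreeCongruence_ker hf.map_smul (fun {x y} => hfs x y)
  have hadm : IsAdmissible N R (T.quot hr) := by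
    refine ⟨?_, hT.isAdmissible.isCofinite.quot hr, j, _, hf.quotLift hr fun _ _ h => h⟩
    intro n hn a ha b
    obtain ⟨v, rfl⟩ := proj_surjective hr a
    obtain ⟨w, rfl⟩ := proj_surjective hr b
    rw [← proj_smul, proj_eq_iff, Setoid.ker_def, hf.map_smul] at ha ⊢
    exact hR j n hn _ ha _
  have heq := hT.ellipticHoms_eq hadm fun χ hχ h v hv => hχ h (T.proj hr v) (by
    rw [← proj_smul, hv])
  rw [← heq] at hχ
  refine hχ h (T.proj hr x) ?_
  rw [← proj_smul, proj_eq_iff, Setoid.ker_def, hf.map_smul, hx]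

/-- Two vertices at distance at most 2 with the same image are in different orbits. -/
theorem IsMinimal.smul_ne [Group.FG H] (hR : ∀ j, IsReduced N (R j)) {T : GTree.{u, v} H}
    (hT : IsMinimal N R T) {j : ℕ} {f : T.V → (R j).V} (hf : IsFold N f) (hfs : IsSimplicial f)
    {y z : T.V} (hne : y ≠ z) (hfyz : f y = f z)
    (hadj : T.graph.Adj y z ∨ (∀ u v, T.graph.Adj u v → f u ≠ f v) ∧
      ∃ x, T.graph.Adj x y ∧ T.graph.Adj x z) (g : H) : g • y ≠ z := by
  intro hg
  -- it suffices to find an invariant cut that separates `y` from `z`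
  suffices hcut : ∃ (D : Set (Sym2 T.V)) (c : T.V → ZMod 2),
      (∀ (h : H) x y, s(h • x, h • y) ∈ D ↔ s(x, y) ∈ D) ∧ IsCut T.graph D c ∧ c z ≠ c y by
    obtain ⟨D, c, hD, hc, hcne⟩ := hcut
    obtain ⟨χ, hχ, hχne⟩ := T.exists_parity_hom hD hc
    exact hχne g y (by rwa [hg]) (hT.apply_eq_one hR hf hfs hχ (hf.smul_eq_of_eq hg hfyz))
  have hinv : ∀ (a b : T.V) (h : H) x y,
      s(h • x, h • y) ∈ {e : Sym2 T.V | ∃ k : H, e = s(k • a, k • b)} ↔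
        s(x, y) ∈ {e : Sym2 T.V | ∃ k : H, e = s(k • a, k • b)} := by
    intro a b h x y
    constructor
    · rintro ⟨k, hk⟩
      refine ⟨h⁻¹ * k, ?_⟩
      rwa [← smul_mk_eq_iff h, smul_smul, smul_smul, mul_inv_cancel_left]
    · rintro ⟨k, hk⟩
      refine ⟨h * k, ?_⟩
      rwa [mul_smul, mul_smul, smul_mk_eq_iff]
  rcases hadj with hyz | ⟨hnd, x, hxy, hxz⟩
  · obtain ⟨c, hc⟩ := T.isTree.exists_isCut {e : Sym2 T.V | ∃ k : H, e = s(k • y, k • z)}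
    exact ⟨_, c, hinv y z, hc, ((hc _ _ hyz).2 ⟨1, by rw [one_smul, one_smul]⟩).symm⟩
  · obtain ⟨c, hc⟩ := T.isTree.exists_isCut {e : Sym2 T.V | ∃ k : H, e = s(k • x, k • y)}
    refine ⟨_, c, hinv x y, hc, ?_⟩
    have h1 : c x ≠ c y := (hc _ _ hxy).2 ⟨1, by rw [one_smul, one_smul]⟩
    -- the edges `xy` and `xz` are in different orbits
    suffices h2 : c x = c z by rwa [← h2]
    by_contra h2
    obtain ⟨k, hk⟩ := (hc _ _ hxz).1 h2
    have hfadj := hfs x y hxy (hnd x y hxy)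
    rcases Sym2.eq_iff.1 hk with ⟨hkx, hky⟩ | ⟨hkx, hky⟩
    · obtain ⟨n, hn, hnx, hny⟩ := hf.lift hxy
        ((separates_iff_of_adj (R j).isTree hfadj).2 rfl) k
        (by rw [← hf.map_smul, ← hkx]) (by rw [← hf.map_smul, ← hky, hfyz])
      rw [mul_smul, ← hkx] at hnx
      rw [mul_smul, ← hky, hT.isAdmissible.isReduced n hn x hnx] at hny
      exact hne hny.symm
    · exact (R j).isTreeAction.no_inversion k hfadj
        ⟨by rw [← hf.map_smul, ← hky, hfyz], by rw [← hf.map_smul, ← hkx]⟩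

/-- In the situation of a fold, if `y` is not a branch vertex then its stabilizer fixes `z`. -/
theorem smul_eq_of_fold {T R : GTree.{u, v} H} (hT : IsReduced N T) {f : T.V → R.V}
    (hf : IsFold N f) (hfs : IsSimplicial f) {y z : T.V} (hfyz : f y = f z)
    (hadj : T.graph.Adj y z ∨ (∀ u v, T.graph.Adj u v → f u ≠ f v) ∧
      ∃ x, T.graph.Adj x y ∧ T.graph.Adj x z) (hy : ¬ T.IsBranch y) {h : H} (hh : h • y = y) :
    h • z = z := by
  rcases hadj with hyz | ⟨hnd, x, hxy, hxz⟩
  · exact smul_eq_of_not_isBranch hy hyz hh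
  · have hx := smul_eq_of_not_isBranch hy hxy.symm hh
    obtain ⟨n, hn, hnx, hnz⟩ := hf.lift hxz
      ((separates_iff_of_adj R.isTree (hfs x z hxz (hnd x z hxz))).2 rfl) h
      (by rw [← hf.map_smul, hx]) (by rw [← hfyz, ← hf.map_smul, hh])
    rw [mul_smul, hx] at hnx
    rwa [mul_smul, hT n hn x hnx] at hnz

end Minimal

end GTree

/-! ### Folding trees of minimal complexity -/

namespace GTree

variable {H : Type u} [Group H] {N : Subgroup H}

section MergeStep

variable {T : GTree.{u, v} H} {y z : T.V}

/-- If no vertex identified with `v` is a branch vertex, an element stabilizing the class of `v`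
fixes `v` up to an element of `mergeKernel`. -/
theorem smul_eq_of_mergeRel (hy : ∀ h : H, ¬ T.IsBranch y → h • y = y → h • z = z)
    (hz : ∀ h : H, ¬ T.IsBranch z → h • z = z → h • y = y)
    (hyz : ∀ g : H, g • y = z → g ∈ mergeStab T y z) {v : T.V} {h : H}
    (hbr : ∀ w, MergeRel N T y z v w → ¬ T.IsBranch w)
    (hv : MergeRel N T y z (h • v) v) : ∃ k ∈ mergeKernel N T y z, (k * h) • v = v := by
  obtain ⟨k, hk, hkv⟩ := hv
  rw [smul_smul] at hkv
  refine ⟨k, hk, ?_⟩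
  rcases hkv with hkv | ⟨g, h1, h2⟩
  · exact hkv
  · have hd := inv_mul_mem_mergeStab hyz h2 h1
    have hgy : ¬ T.IsBranch y := fun hb => hbr (g • y)
      ⟨1, one_mem _, Or.inr ⟨g, by rwa [one_smul], mem_mergeBlock_left g⟩⟩ (hb.smul g)
    have hgz : ¬ T.IsBranch z := fun hb => hbr (g • z)
      ⟨1, one_mem _, Or.inr ⟨g, by rwa [one_smul], mem_mergeBlock_right g⟩⟩ (hb.smul g)
    -- the stabilizers of `y` and `z` agree, so that `mergeStab` fixes both
    have hle : mergeStab T y z ≤ MulAction.stabilizer H y ⊓ MulAction.stabilizer H z :=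
      sup_le (fun a ha => ⟨ha, hy a hgy ha⟩) (fun a ha => ⟨hz a hgz ha, ha⟩)
    obtain ⟨d, hdm, hv⟩ := h2
    have hda := hle hdm
    have hfix := hle hd
    rcases hv with rfl | rfl
    · have h3 : (g * d) • y = g • y := by rw [mul_smul, MulAction.mem_stabilizer_iff.1 hda.1]
      have h4 : (g⁻¹ * (k * h) * g) • y = y := hfix.1
      rw [h3]
      rwa [mul_assoc, mul_smul, inv_smul_eq_iff, mul_smul] at h4
    · have h3 : (g * d) • z = g • z := by rw [mul_smul, MulAction.mem_stabilizer_iff.1 hda.2]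
      have h4 : (g⁻¹ * (k * h) * g) • z = z := hfix.2
      rw [h3]
      rwa [mul_assoc, mul_smul, inv_smul_eq_iff, mul_smul] at h4

/-- Branch vertices of the quotient come from branch vertices. -/
theorem branchOrbits_merge_subset [N.Normal]
    (hy : ∀ h : H, ¬ T.IsBranch y → h • y = y → h • z = z)
    (hz : ∀ h : H, ¬ T.IsBranch z → h • z = z → h • y = y)
    (hyz : ∀ g : H, g • y = z → g ∈ mergeStab T y z)
    (hr : IsTreeCongruence T (mergeSetoid N hyz)) :
    (T.quot hr).branchOrbits ⊆
      orbitMap (R := T.quot hr) (T.proj hr) (proj_smul hr) '' T.branchOrbits := by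
  rintro _ ⟨a, ⟨b, hab, h, ha, hb⟩, rfl⟩
  obtain ⟨v, u, hvu, -, rfl, rfl⟩ := quot_adj hr hab
  by_contra hno
  have hbr : ∀ w, MergeRel N T y z v w → ¬ T.IsBranch w := by
    intro w hw hbw
    refine hno ⟨T.orbitMk w, ⟨w, hbw, rfl⟩, ?_⟩
    rw [orbitMap_mk, (proj_eq_iff hr).2 (hw.symm' hyz)]
  rw [← proj_smul, proj_eq_iff] at ha
  obtain ⟨k, hk, hkv⟩ := smul_eq_of_mergeRel hy hz hyz hbr ha
  have hku := smul_eq_of_not_isBranch (hbr v ((mergeSetoid N hyz).refl' v)) hvu hkv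
  refine hb ?_
  rw [← proj_smul, proj_eq_iff]
  have := mergeRel_of_mem hk (h • u)
  rwa [smul_smul, hku] at this

/-- If the stabilizer of `y` fixes `z` or conversely, no element of `N` starts to act trivially
when `y` and `z` are merged. -/
theorem trivial_of_trivial_merge (hT : IsReduced N T)
    (hyz : ∀ g : H, g • y = z → g ∈ mergeStab T y z)
    (hD : mergeStab T y z = MulAction.stabilizer H y ∨
      mergeStab T y z = MulAction.stabilizer H z) {n : H} (hn : n ∈ N)
    (h : MergeRel N T y z (n • y) y) : ∀ v : T.V, n • v = v := by
  have hconj : ∀ m ∈ N, ∀ g : H, g⁻¹ * m * g ∈ mergeStab T y z → ∀ v : T.V, m • v = v := by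
    intro m hm g hg
    have : ∃ x : T.V, (g⁻¹ * m * g) • x = x := by
      rcases hD with hD | hD <;> rw [hD] at hg
      · exact ⟨y, hg⟩
      · exact ⟨z, hg⟩
    obtain ⟨x, hx⟩ := this
    refine hT m hm (g • x) ?_
    rwa [mul_assoc, mul_smul, inv_smul_eq_iff, mul_smul] at hx
  have hker : ∀ k ∈ mergeKernel N T y z, ∀ v : T.V, k • v = v := by
    intro k hk
    induction hk using Subgroup.closure_induction with
    | mem m hm =>
      obtain ⟨hm, ⟨w, hw⟩ | ⟨g, hg⟩⟩ := hm
      · exact hT m hm w hw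
      · exact hconj m hm g hg
    | one => exact fun v => one_smul _ v
    | mul a b _ _ ha hb => exact fun v => by rw [mul_smul, hb, ha]
    | inv a _ ha => exact fun v => by rw [inv_smul_eq_iff, ha]
  obtain ⟨k, hk, hkv⟩ := h
  rw [smul_smul] at hkv
  have hkn : k * n ∈ N := N.mul_mem (mergeKernel_le hk) hn
  have htriv : ∀ v : T.V, (k * n) • v = v := by
    rcases hkv with hkv | ⟨g, h1, h2⟩
    · exact hT _ hkn y hkv
    · exact hconj _ hkn g (inv_mul_mem_mergeStab hyz h2 h1)
  intro v
  have := htriv v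
  rwa [mul_smul, hker k hk] at this

end MergeStep

variable {R : ℕ → GTree.{u, v} H}

/-- Folding or collapsing an edge of a tree of minimal complexity produces a tree of minimal
complexity with fewer orbits of vertices, and does not change which elements of `N` act
trivially. -/
theorem IsMinimal.exists_merge [N.Normal] [Group.FG H] (hR : ∀ j, IsReduced N (R j))
    {T : GTree.{u, v} H} (hT : IsMinimal N R T) {j : ℕ} {f : T.V → (R j).V} (hf : IsFold N f)
    (hfs : IsSimplicial f) {y z : T.V} (hne : y ≠ z) (hfyz : f y = f z)
    (hadj : T.graph.Adj y z ∨ (∀ u v, T.graph.Adj u v → f u ≠ f v) ∧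
      ∃ x, T.graph.Adj x y ∧ T.graph.Adj x z) :
    ∃ (T' : GTree.{u, v} H) (f' : T'.V → (R j).V), IsMinimal N R T' ∧ IsFold N f' ∧
      IsSimplicial f' ∧ Nat.card (MulAction.orbitRel.Quotient H T'.V) <
        Nat.card (MulAction.orbitRel.Quotient H T.V) ∧
      ∀ n ∈ N, (∀ v : T'.V, n • v = v) → ∀ v : T.V, n • v = v := by
  have hred := hT.isAdmissible.isReduced
  have horb := hT.smul_ne hR hf hfs hne hfyz hadj
  have hyz : ∀ g : H, g • y = z → g ∈ mergeStab T y z := fun g hg => absurd hg (horb g)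
  have hrel : ∀ v w, MergeRel N T y z v w → f v = f w := fun v w h =>
    h.map_eq (hR j) hf.map_smul hfyz
  have hr : IsTreeCongruence T (mergeSetoid N hyz) := by
    rcases hadj with hadj | ⟨hnd, hadj⟩
    · exact isTreeCongruence_merge_of_adj hyz (Or.inr hadj)
    · exact isTreeCongruence_merge_of_common hyz hadj hf.map_smul hrel
        fun v w hvw => hfs v w hvw (hnd v w hvw)
  have hadj' : T.graph.Adj z y ∨ (∀ u v, T.graph.Adj u v → f u ≠ f v) ∧
      ∃ x, T.graph.Adj x z ∧ T.graph.Adj x y :=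
    hadj.imp SimpleGraph.Adj.symm (And.imp_right fun ⟨x, h1, h2⟩ => ⟨x, h2, h1⟩)
  have hstaby : ∀ h : H, ¬ T.IsBranch y → h • y = y → h • z = z := fun h hb hh =>
    smul_eq_of_fold hred hf hfs hfyz hadj hb hh
  have hstabz : ∀ h : H, ¬ T.IsBranch z → h • z = z → h • y = y := fun h hb hh =>
    smul_eq_of_fold hred hf hfs hfyz.symm hadj' hb hh
  have hfold : IsFold N (quotLift hr hrel : (T.quot hr).V → (R j).V) := hf.quotLift hr hrel
  have hadm : IsAdmissible N R (T.quot hr) :=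
    ⟨isReduced_merge hyz hr, hT.isAdmissible.isCofinite.quot hr, j, _, hfold⟩
  have hell : (T.quot hr).ellipticHoms ⊆ T.ellipticHoms := fun χ hχ h v hv =>
    hχ h (T.proj hr v) (by rw [← proj_smul, hv])
  have hfin := hT.isAdmissible.isCofinite.vertices
  have hfin' := hadm.isCofinite.vertices
  have hsub := branchOrbits_merge_subset hstaby hstabz hyz hr
  have hpyz : T.proj hr y = T.proj hr z := by
    rw [proj_eq_iff]
    have := mergeRel_pair (N := N) (y := y) (z := z) 1
    rwa [one_smul, one_smul] at this
  have hle : (T.quot hr).branchOrbits.ncard ≤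
      (orbitMap (R := T.quot hr) (T.proj hr) (proj_smul hr) '' T.branchOrbits).ncard :=
    Set.ncard_le_ncard hsub (Set.toFinite _)
  have hle' := Set.ncard_image_le (f := orbitMap (R := T.quot hr) (T.proj hr) (proj_smul hr))
    (Set.toFinite T.branchOrbits)
  have horbne : T.orbitMk y ≠ T.orbitMk z := by
    rw [ne_comm, Ne, orbitMk_eq_iff]
    rintro ⟨h, hh⟩
    exact horb h hh
  have horbeq : orbitMap (R := T.quot hr) (T.proj hr) (proj_smul hr) (T.orbitMk y) =
      orbitMap (R := T.quot hr) (T.proj hr) (proj_smul hr) (T.orbitMk z) := by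
    rw [orbitMap_mk, orbitMap_mk, hpyz]
  refine ⟨T.quot hr, _, hT.of_le hadm hell (hle.trans hle'), hfold, ?_, ?_, ?_⟩
  · intro a b hab hfne
    obtain ⟨v, w, hvw, -, rfl, rfl⟩ := quot_adj hr hab
    exact hfs v w hvw hfne
  · refine lt_of_le_of_ne (Nat.card_le_card_of_surjective _ (orbitMap_surjective
      (R := T.quot hr) (proj_smul hr) (proj_surjective hr))) fun hcard => ?_
    have hbij := (Nat.bijective_iff_surjective_and_card (orbitMap (R := T.quot hr) (T.proj hr)
      (proj_smul hr))).2 ⟨orbitMap_surjective (R := T.quot hr) (proj_smul hr)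
        (proj_surjective hr), hcard.symm⟩
    exact horbne (hbij.1 horbeq)
  · intro n hn htriv
    have hmem : MergeRel N T y z (n • y) y := by
      have := htriv (T.proj hr y)
      rwa [← proj_smul, proj_eq_iff] at this
    refine trivial_of_trivial_merge hred hyz ?_ hn hmem
    -- if `y` and `z` were both branch vertices, merging them would lower the complexity
    by_cases hby : T.IsBranch y
    · by_cases hbz : T.IsBranch z
      · have hcard := hle'.antisymm ((hT.branchOrbits_le hadm hell).trans hle)
        have hinj := Set.injOn_of_ncard_image_eq hcard (Set.toFinite _)
        exact absurd (hinj ⟨y, hby, rfl⟩ ⟨z, hbz, rfl⟩ horbeq) horbne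
      · exact Or.inl (sup_eq_left.2 fun a ha => hstabz a hbz ha)
    · exact Or.inr (sup_eq_right.2 fun a ha => hstaby a hby ha)

/-- A simplicial map between trees that is not injective collapses an edge or folds two edges. -/
theorem exists_fold_of_not_injective {T R : GTree.{u, v} H} {f : T.V → R.V}
    (hfs : IsSimplicial f) (hf : ¬ Function.Injective f) :
    ∃ y z, y ≠ z ∧ f y = f z ∧ (T.graph.Adj y z ∨ (∀ u v, T.graph.Adj u v → f u ≠ f v) ∧
      ∃ x, T.graph.Adj x y ∧ T.graph.Adj x z) := by
  by_cases hnd : ∀ u v, T.graph.Adj u v → f u ≠ f v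
  · by_contra! hno
    refine hf fun a b hab => ?_
    let φ : T.graph →g R.graph := ⟨f, fun {x y} h => hfs x y h (hnd x y h)⟩
    -- the image of a path does not backtrack, hence is a path
    have key : ∀ {a b : T.V} (w : T.graph.Walk a b), w.IsPath →
        (w.map φ).edges.IsChain (· ≠ ·) := by
      intro a b w
      induction w with
      | nil => simp
      | @cons a c b h w ih =>
        intro hw
        cases w with
        | nil => simp
        | @cons _ d _ h' w =>
          have := ih hw.of_cons
          rw [SimpleGraph.Walk.map_cons, SimpleGraph.Walk.map_cons, SimpleGraph.Walk.edges_cons,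
            SimpleGraph.Walk.edges_cons, List.isChain_cons_cons]
          rw [SimpleGraph.Walk.map_cons, SimpleGraph.Walk.edges_cons] at this
          refine ⟨fun he => ?_, this⟩
          have had : a ≠ d := by
            rintro rfl
            rw [SimpleGraph.Walk.cons_isPath_iff] at hw
            exact hw.2 (by simp)
          have hfad : f a = f d := by
            rcases Sym2.eq_iff.1 he with ⟨h1, h2⟩ | ⟨h1, -⟩
            · exact absurd h1 (hnd _ _ h)
            · exact h1
          exact (hno a d had hfad).2 hnd c h.symm h'
    obtain ⟨w, hw, -⟩ := T.isTree.existsUnique_path a b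
    have hpath := (R.isTree.isAcyclic.isPath_iff_isChain _).2 (key w hw)
    have hlen : (w.map φ).length = 0 := by
      have : ∀ {x y : R.V} (p : R.graph.Walk x y), p.IsPath → x = y → p.length = 0 := by
        rintro x y p hp rfl
        exact SimpleGraph.Walk.length_eq_zero_iff.2 (SimpleGraph.Walk.isPath_iff_nil.1 hp)
      exact this _ hpath hab
    rw [SimpleGraph.Walk.length_map] at hlen
    exact SimpleGraph.Walk.eq_of_length_eq_zero hlen
  · push Not at hnd
    obtain ⟨u, v, huv, hfuv⟩ := hnd
    exact ⟨u, v, huv.ne, hfuv, Or.inl huv⟩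

/-- If a tree `T` of minimal complexity maps simplicially to `R j`, the elements of `N` acting
trivially on `R j` act trivially on `T`. -/
theorem IsMinimal.trivial_of_simplicial [N.Normal] [Group.FG H] (hR : ∀ j, IsReduced N (R j))
    {T : GTree.{u, v} H} (hT : IsMinimal N R T) {j : ℕ} {f : T.V → (R j).V} (hf : IsFold N f)
    (hfs : IsSimplicial f) {n : H} (hn : n ∈ N) (htriv : ∀ v : (R j).V, n • v = v) (v : T.V) :
    n • v = v := by
  induction hm : Nat.card (MulAction.orbitRel.Quotient H T.V) using Nat.strong_induction_on
    generalizing T with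
  | _ m ih =>
    by_cases hinj : Function.Injective f
    · exact hinj (by rw [hf.map_smul, htriv])
    · obtain ⟨y, z, hne, hfyz, hadj⟩ := exists_fold_of_not_injective hfs hinj
      obtain ⟨T', f', hT', hf', hfs', hcard, h⟩ := hT.exists_merge hR hf hfs hne hfyz hadj
      exact h n hn (fun v => ih _ (hm ▸ hcard) hT' hf' hfs' v rfl) v

/-- The same for an arbitrary map, which becomes simplicial after subdividing. -/
theorem IsMinimal.trivial_of_isFold [N.Normal] [Group.FG H] (hR : ∀ j, IsReduced N (R j))
    {T : GTree.{u, v} H} (hT : IsMinimal N R T) {j : ℕ} {f : T.V → (R j).V} (hf : IsFold N f)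
    {n : H} (hn : n ∈ N) (htriv : ∀ v : (R j).V, n • v = v) (v : T.V) : n • v = v := by
  -- the images of edges have bounded length, as there are finitely many orbits of edges
  obtain ⟨L, hL⟩ : ∃ L, ∀ x y, T.graph.Adj x y → WalkLE (R j).graph (L + 1) (f x) (f y) := by
    obtain ⟨s, hs, hsT⟩ := hT.isAdmissible.isCofinite.edges
    have hdist : ∀ p : T.V × T.V, ∃ l, WalkLE (R j).graph l (f p.1) (f p.2) := fun p =>
      let w := ((R j).preconnected (f p.1) (f p.2)).some
      ⟨w.length, w, le_rfl⟩
    choose l hl using hdist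
    obtain ⟨L, hL⟩ := (hs.image l).bddAbove
    refine ⟨L, fun x y hxy => ?_⟩
    obtain ⟨g, hg⟩ := hsT x y hxy
    have h1 := (hl (g • x, g • y)).mono ((hL ⟨_, hg, rfl⟩).trans (Nat.le_succ L))
    rw [hf.map_smul, hf.map_smul] at h1
    simpa using h1.smul g⁻¹
  induction L generalizing T with
  | zero =>
    refine hT.trivial_of_simplicial hR hf (fun x y hxy hne => ?_) hn htriv v
    obtain ⟨w, hw⟩ := hL x y hxy
    rw [zero_add] at hw
    refine SimpleGraph.Walk.adj_of_length_eq_one (p := w) (le_antisymm hw ?_)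
    by_contra hlt
    exact hne (SimpleGraph.Walk.eq_of_length_eq_zero (p := w) (by omega))
  | succ L ih =>
    obtain ⟨f', hf', hL'⟩ := hf.exists_subdiv hL
    have := ih (hT.subdiv hf') hf' (T.oldVertex v) fun a b hab =>
      (hL' a b hab).mono (by omega)
    exact oldVertex_injective this

/-- For a sequence of reduced trees on which every element of `N` eventually acts trivially, there
is a cofinite tree on which `N` acts trivially and which maps to one of them. -/
theorem exists_trivial_isFold [N.Normal] [Group.FG H] (hR : ∀ j, IsReduced N (R j))
    (hmap : ∀ j, ∃ g : (R j).V → (R (j + 1)).V, IsFold N g)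
    (hN : ∀ n ∈ N, ∃ i, ∀ j, i ≤ j → ∀ v : (R j).V, n • v = v) :
    ∃ (T : GTree.{u, v} H) (j : ℕ) (f : T.V → (R j).V), IsCofinite T ∧ IsFold N f ∧
      ∀ n ∈ N, ∀ v : T.V, n • v = v := by
  obtain ⟨T₀, f₀, hcof₀, hred₀, hf₀⟩ := exists_cofinite_subtree N (R 0) (hR 0)
  obtain ⟨T, hT⟩ := exists_isMinimal (R := R) ⟨hred₀, hcof₀, 0, f₀, hf₀⟩
  obtain ⟨i, f, hf⟩ := hT.isAdmissible.exists_isFold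
  have hall : ∀ j, i ≤ j → ∃ f : T.V → (R j).V, IsFold N f := by
    intro j hij
    induction j, hij using Nat.le_induction with
    | base => exact ⟨f, hf⟩
    | succ j _ ih =>
      obtain ⟨f, hf⟩ := ih
      obtain ⟨g, hg⟩ := hmap j
      exact ⟨_, hg.comp hf⟩
  refine ⟨T, i, f, hT.isAdmissible.isCofinite, hf, fun n hn v => ?_⟩
  obtain ⟨l, hl⟩ := hN n hn
  obtain ⟨f', hf'⟩ := hall (max i l) (le_max_left _ _)
  exact hT.trivial_of_isFold hR hf' hn (hl _ (le_max_right _ _)) v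

end GTree

/-! ### Collapsing a tree to a single orbit of edges -/

namespace GTree

variable {H : Type u} [Group H] (T : GTree.{u, v} H)

/-- The vertices `v` and `w` are not separated by any translate of the edge `xy`. -/
def collapseSetoid (x y : T.V) : Setoid T.V where
  r v w := ∀ g : H, ¬ Separates T.graph (g • x) (g • y) v w
  iseqv := ⟨fun _ _ h => h.ne T.isTree rfl, fun h g hs => h g hs.symm,
    fun {_ v _} h h' g hs => (hs.or T.isTree v).elim (h g) (h' g)⟩

variable {T}

theorem collapseSetoid_smul {x y v w : T.V} (h : H) (hvw : T.collapseSetoid x y v w) :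
    T.collapseSetoid x y (h • v) (h • w) := by
  intro g hs
  have := T.isTreeAction.separates_smul h⁻¹ hs
  rw [inv_smul_smul, inv_smul_smul, smul_smul, smul_smul] at this
  exact hvw _ this

theorem exists_mk_eq_of_not_collapse {x y a b : T.V} (hab : T.graph.Adj a b)
    (hne : ¬ T.collapseSetoid x y a b) : ∃ g : H, s(a, b) = s(g • x, g • y) := by
  obtain ⟨g, hg⟩ := not_forall.1 hne
  exact ⟨g, (separates_iff_of_adj T.isTree hab).1 (not_not.1 hg)⟩

theorem not_collapse_of_adj {x y : T.V} (hxy : T.graph.Adj x y) : ¬ T.collapseSetoid x y x y := by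
  intro h
  refine h 1 ?_
  rw [one_smul, one_smul]
  exact (separates_iff_of_adj T.isTree hxy).2 rfl

/-- The cut along an edge which is not collapsed descends to the quotient. -/
theorem exists_isCut_collapse {x y a b : T.V} (hab : T.graph.Adj a b)
    (hne : ¬ T.collapseSetoid x y a b) : ∃ c : T.V → ZMod 2, IsCut T.graph {s(a, b)} c ∧
      ∀ u v, T.collapseSetoid x y u v → c u = c v := by
  obtain ⟨g, hg⟩ := exists_mk_eq_of_not_collapse hab hne
  obtain ⟨c, hc⟩ := T.isTree.exists_isCut {s(a, b)}
  refine ⟨c, hc, fun u v huv => ?_⟩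
  rw [hg] at hc
  by_contra hcne
  exact huv g ((hc.separates_iff T.preconnected u v).2 hcne)

theorem smul_eq_of_collapse {x y a b : T.V} (hab : T.graph.Adj a b)
    (hne : ¬ T.collapseSetoid x y a b) {h : H}
    (hh : T.collapseSetoid x y (h • a) a ∧ T.collapseSetoid x y (h • b) b ∨
      T.collapseSetoid x y (h • a) b ∧ T.collapseSetoid x y (h • b) a) :
    h • a = a ∧ h • b = b := by
  obtain ⟨c, hc, hcr⟩ := exists_isCut_collapse hab hne
  have hcab : c a ≠ c b := (hc _ _ hab).2 rfl
  refine T.isTreeAction.fixed_of_mk_eq hab ((hc _ _ (T.isTreeAction.smul_adj h hab)).1 ?_)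
  rcases hh with ⟨h1, h2⟩ | ⟨h1, h2⟩
  · rwa [hcr _ _ h1, hcr _ _ h2]
  · rw [hcr _ _ h1, hcr _ _ h2]
    exact hcab.symm

/-- Collapsing all edges outside the orbit of `xy` produces a tree. -/
theorem isTreeCongruence_collapse (x y : T.V) : IsTreeCongruence T (T.collapseSetoid x y) where
  smul h _ _ hvw := collapseSetoid_smul h hvw
  cut {a b} hab hne := by
    obtain ⟨c, hc, hcr⟩ := exists_isCut_collapse hab hne
    refine ⟨c, hcr, (hc _ _ hab).2 rfl, fun u v huv hcuv => ?_⟩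
    rcases Sym2.eq_iff.1 ((hc _ _ huv).1 hcuv) with ⟨rfl, rfl⟩ | ⟨rfl, rfl⟩
    · exact Or.inl ⟨(T.collapseSetoid x y).refl' _, (T.collapseSetoid x y).refl' _⟩
    · exact Or.inr ⟨(T.collapseSetoid x y).refl' _, (T.collapseSetoid x y).refl' _⟩
  no_inversion h a b hab hne h1 h2 := by
    have := (smul_eq_of_collapse hab hne (Or.inr ⟨h1, h2⟩)).1
    rw [this] at h1
    exact hne h1

/-- Each class of `collapseSetoid` is a subtree: it contains the endpoints of the edges that
separate two of its elements. -/
theorem collapse_of_separates {x y w a b u v : T.V} (ha : T.collapseSetoid x y w a)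
    (hb : T.collapseSetoid x y w b) (hs : Separates T.graph u v a b) :
    T.collapseSetoid x y w u := by
  classical
  intro g hg
  have hadj := hs.adj T.isTree
  have hpre := T.preconnected
  obtain ⟨c, hc⟩ := T.isTree.exists_isCut {s(u, v)}
  obtain ⟨c', hc'⟩ := T.isTree.exists_isCut {s(g • x, g • y)}
  have hwa : c' a = c' w := by
    have := (hc'.separates_iff hpre w a).not.1 (ha g)
    exact (not_not.1 this).symm
  have hwb : c' b = c' w := by
    have := (hc'.separates_iff hpre w b).not.1 (hb g)
    exact (not_not.1 this).symm
  have hwu : c' u ≠ c' w := ((hc'.separates_iff hpre w u).1 hg).symm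
  have hcab := (hc.separates_iff hpre a b).1 hs
  have hwv : c' v ≠ c' w := by
    intro hwv
    -- otherwise `uv` is the edge `(g • x)(g • y)`, which does not separate `a` from `b`
    have huv : s(u, v) = s(g • x, g • y) := (hc' u v hadj).1 (by rw [hwv]; exact hwu)
    rw [huv] at hc
    exact hcab ((hc.eq_iff_eq hpre hc' a b).2 (hwa.trans hwb.symm))
  -- the endpoint of `(g • x)(g • y)` on the side of `w`
  obtain ⟨p, q, hpq, hp⟩ : ∃ p q, s(g • x, g • y) = s(p, q) ∧ c' p = c' w := by
    have hne := (hc' _ _ (hg.adj T.isTree)).2 rfl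
    have haux : ∀ {a b d : ZMod 2}, a ≠ b → a = d ∨ b = d := by decide
    rcases haux hne with h | h
    · exact ⟨_, _, rfl, h⟩
    · exact ⟨_, _, Sym2.eq_swap, h⟩
  have hq : c' q ≠ c' w := by
    rw [← hp]
    have hxy := hg.adj T.isTree
    have hadj : T.graph.Adj p q := by
      rw [← SimpleGraph.mem_edgeSet, ← hpq]
      exact hxy
    exact ((hc' p q hadj).2 hpq.symm).symm
  -- the cut `c`, made constant on the side of `(g • x)(g • y)` that contains `uv`
  have hconst := eq_of_forall_adj_eq hpre (f := fun t => if c' t = c' w then c t else c p) (by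
    intro s t hst
    by_cases hs' : c' s = c' w <;> by_cases ht' : c' t = c' w
    · simp only [hs', ht', if_true]
      by_contra hne
      rcases Sym2.eq_iff.1 ((hc s t hst).1 hne) with ⟨rfl, rfl⟩ | ⟨rfl, rfl⟩
      · exact hwu hs'
      · exact hwu ht'
    · simp only [hs', ht', if_true, if_false]
      have := (hc' s t hst).1 (by rw [hs']; exact Ne.symm ht')
      rw [hpq] at this
      rcases Sym2.eq_iff.1 this with ⟨rfl, rfl⟩ | ⟨rfl, rfl⟩
      · rfl
      · exact absurd hs' hq
    · simp only [hs', ht', if_true, if_false]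
      have := (hc' s t hst).1 (by rw [ht']; exact hs')
      rw [hpq] at this
      rcases Sym2.eq_iff.1 this with ⟨rfl, rfl⟩ | ⟨rfl, rfl⟩
      · exact absurd ht' hq
      · rfl
    · simp only [hs', ht', if_false]) a b
  simp only [hwa, hwb, if_true] at hconst
  exact hcab hconst

/-- A vertex `v` has a closest point in the class of `w`: the edges separating it from `v` do not
separate any two elements of the class. -/
theorem exists_gate (x y w v : T.V) : ∃ v', T.collapseSetoid x y w v' ∧
    ∀ p q, Separates T.graph p q v v' → ∀ a b, T.collapseSetoid x y w a →
      T.collapseSetoid x y w b → ¬ Separates T.graph p q a b := by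
  obtain ⟨W⟩ := T.preconnected v w
  have hw : T.collapseSetoid x y w w := (T.collapseSetoid x y).refl' w
  generalize hw' : w = w' at W
  induction W with
  | nil =>
    subst hw'
    exact ⟨_, hw, fun p q h => absurd rfl (h.ne T.isTree)⟩
  | @cons v u _ hvu _ ih =>
    subst hw'
    by_cases hv : T.collapseSetoid x y w v
    · exact ⟨v, hv, fun p q h => absurd rfl (h.ne T.isTree)⟩
    · obtain ⟨v', hv', h⟩ := ih rfl
      refine ⟨v', hv', fun p q hpq a b ha hb hab => ?_⟩
      rcases hpq.or T.isTree u with hvu' | huv'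
      · refine hv ?_
        rcases Sym2.eq_iff.1 ((separates_iff_of_adj T.isTree hvu).1 hvu') with
          ⟨rfl, rfl⟩ | ⟨rfl, rfl⟩
        · exact collapse_of_separates ha hb hab
        · exact collapse_of_separates ha hb (separates_swap.1 hab)
      · exact h p q huv' a b ha hb hab

/-- If each of finitely many one-edge collapses of `T` has a fixed vertex, then some vertex of `T`
maps to a fixed vertex in all of them. -/
theorem exists_common_fixed {s : Set (T.V × T.V)} (hs : s.Finite)
    (hex : ∀ p ∈ s, ∃ w, ∀ h : H, T.collapseSetoid p.1 p.2 w (h • w)) :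
    ∃ v, ∀ p ∈ s, ∀ h : H, T.collapseSetoid p.1 p.2 v (h • v) := by
  induction s, hs using Set.Finite.induction_on with
  | empty =>
    obtain ⟨v⟩ := T.isTree.connected.nonempty
    exact ⟨v, fun p hp => absurd hp (Set.notMem_empty p)⟩
  | @insert e s _ _ ih =>
    obtain ⟨v, hv⟩ := ih fun p hp => hex p (Set.mem_insert_of_mem _ hp)
    obtain ⟨w, hw⟩ := hex e (Set.mem_insert _ _)
    obtain ⟨v', hv', hgate⟩ := exists_gate e.1 e.2 w v
    have hinv : ∀ h : H, T.collapseSetoid e.1 e.2 w (h • v') := fun h =>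
      (T.collapseSetoid e.1 e.2).trans' (hw h) (collapseSetoid_smul h hv')
    refine ⟨v', fun p hp h => ?_⟩
    rcases Set.mem_insert_iff.1 hp with hpe | hp
    · rw [hpe]
      exact (T.collapseSetoid e.1 e.2).trans' ((T.collapseSetoid e.1 e.2).symm' hv') (hinv h)
    · -- an edge separating `v'` from `h • v'` also separates `v` from `h • v`
      intro g hg
      have h1 : ¬ Separates T.graph (g • p.1) (g • p.2) v v' := fun hs =>
        hgate _ _ hs _ _ hv' (hinv h) hg
      have h2 : ¬ Separates T.graph (g • p.1) (g • p.2) (h • v) (h • v') := by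
        intro hs
        have hs := T.isTreeAction.separates_smul h⁻¹ hs
        have hg := T.isTreeAction.separates_smul h⁻¹ hg
        rw [inv_smul_smul, inv_smul_smul] at hs
        rw [inv_smul_smul] at hg
        exact hgate _ _ hs _ _ (hinv h⁻¹) hv' hg
      rcases hg.or T.isTree v with hs | hs
      · exact h1 hs.symm
      · rcases hs.or T.isTree (h • v) with hs | hs
        · exact hv p hp h g hs
        · exact h2 hs

/-- Let `f` be an equivariant map to a set without fixed point. Then some edge whose endpoints have
different images gives a one-edge collapse without fixed vertex. -/
theorem exists_nontrivial_collapse (hT : IsCofinite T) {X : Type*} [MulAction H X] {f : T.V → X}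
    (hf : ∀ (h : H) (v : T.V), f (h • v) = h • f v) (hX : ¬ ∃ x : X, ∀ h : H, h • x = x) :
    ∃ x y, T.graph.Adj x y ∧ f x ≠ f y ∧
      ¬ ∃ w, ∀ h : H, T.collapseSetoid x y w (h • w) := by
  by_contra! hno
  obtain ⟨s, hs, hsT⟩ := hT.edges
  obtain ⟨v, hv⟩ := exists_common_fixed (s := s ∩ {p | T.graph.Adj p.1 p.2 ∧ f p.1 ≠ f p.2})
    (hs.subset Set.inter_subset_left) fun p hp => hno p.1 p.2 hp.2.1 hp.2.2
  refine hX ⟨f v, fun h => ?_⟩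
  by_contra hne
  rw [← hf] at hne
  obtain ⟨a, b, hab, hsep, hfab⟩ := exists_separates_of_ne T.isTree f (Ne.symm hne)
  obtain ⟨g, hg⟩ := hsT a b hab
  refine hv (g • a, g • b) ⟨hg, T.isTreeAction.smul_adj g hab, ?_⟩ h g⁻¹ ?_
  · rwa [hf, hf, Ne, smul_left_cancel_iff]
  · rwa [inv_smul_smul, inv_smul_smul]

/-- A tree without fixed vertex and with one orbit of edges, on which the kernel of a surjective
homomorphism `Φ : H → G` acts trivially, is a splitting of `G`. -/
theorem hasNontrivialSplittingOver_of_surjective {G : Type u} [Group G] {Φ : H →* G}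
    (hΦ : Function.Surjective Φ) (hker : ∀ n, Φ n = 1 → ∀ v : T.V, n • v = v)
    (hfix : ¬ ∃ v : T.V, ∀ h : H, h • v = v)
    (horb : ∀ a b a' b' : T.V, T.graph.Adj a b → T.graph.Adj a' b' →
      ∃ h : H, (h • a = a' ∧ h • b = b') ∨ (h • a = b' ∧ h • b = a'))
    {a b : T.V} (hab : T.graph.Adj a b) :
    HasNontrivialSplittingOver.{u, v} G ((edgeStabilizer H a b).map Φ) := by
  choose σ hσ using hΦ
  have hact : ∀ {h h' : H}, Φ h = Φ h' → ∀ v : T.V, h • v = h' • v := by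
    intro h h' he v
    have := hker (h'⁻¹ * h) (by rw [map_mul, map_inv, he, inv_mul_cancel]) v
    rwa [mul_smul, inv_smul_eq_iff] at this
  let A : MulAction G T.V :=
    { smul := fun g v => σ g • v
      one_smul := fun v => hker _ (hσ 1) v
      mul_smul := fun g g' v => by
        change σ (g * g') • v = σ g • σ g' • v
        rw [← mul_smul]
        exact hact (by rw [map_mul, hσ, hσ, hσ]) v }
  have hA : ∀ (h : H) (v : T.V), Φ h • v = h • v := fun h v => hact (hσ (Φ h)) v
  have hA' : ∀ (g : G) (v : T.V), g • v = σ g • v := fun _ _ => rfl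
  refine ⟨T.V, A, T.graph, ⟨T.isTree, ?_, ?_⟩, ?_, ?_, a, b, hab, ?_⟩
  · exact fun g _ _ h => T.isTreeAction.smul_adj (σ g) h
  · exact fun g _ _ h => T.isTreeAction.no_inversion (σ g) h
  · rintro ⟨v, hv⟩
    exact hfix ⟨v, fun h => by rw [← hA, hv]⟩
  · intro a b a' b' h h'
    obtain ⟨k, hk⟩ := horb a b a' b' h h'
    exact ⟨Φ k, by simpa only [hA] using hk⟩
  · ext g
    constructor
    · rintro ⟨h1, h2⟩
      exact ⟨σ g, ⟨h1, h2⟩, hσ g⟩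
    · rintro ⟨h, ⟨h1, h2⟩, rfl⟩
      exact ⟨(hA h a).trans h1, (hA h b).trans h2⟩

end GTree

/-! ### The direct limit -/

section Limit

variable {G : ℕ → Type u} [∀ k, Group (G k)] (φ : ∀ k, G k →* G (k + 1))

theorem seqMap_surjective (hφ : ∀ k, Function.Surjective (φ k)) {i j : ℕ} (h : i ≤ j) :
    Function.Surjective (seqMap φ h) := by
  induction j, h using Nat.le_induction with
  | base =>
    rw [seqMap_self]
    exact Function.surjective_id
  | succ j h ih =>
    rw [seqMap_succ φ h]
    exact (hφ j).comp ih

theorem toSeqLimit_seqMap {i j : ℕ} (h : i ≤ j) (x : G i) :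
    toSeqLimit φ j (seqMap φ h x) = toSeqLimit φ i x := by
  refine Quotient.sound ⟨j, le_refl j, h, ?_⟩
  exact DirectedSystem.map_self (f := fun _ _ h => seqMap φ h) _

theorem toSeqLimit_surjective (hφ : ∀ k, Function.Surjective (φ k)) (i : ℕ) :
    Function.Surjective (toSeqLimit φ i) := by
  intro g
  induction g using DirectLimit.induction with | _ j x
  obtain ⟨y, hy⟩ := seqMap_surjective φ hφ (le_max_right i j) (seqMap φ (le_max_right i j) 1)
  obtain ⟨z, hz⟩ := seqMap_surjective φ hφ (le_max_left i j) (seqMap φ (le_max_right i j) x)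
  refine ⟨z, ?_⟩
  rw [← toSeqLimit_seqMap φ (le_max_left i j), hz, toSeqLimit_seqMap]
  rfl

theorem exists_seqMap_eq_one {i : ℕ} {x : G i} (hx : toSeqLimit φ i x = 1) :
    ∃ j, ∀ k, j ≤ k → ∀ h : i ≤ k, seqMap φ h x = 1 := by
  obtain ⟨j, hij, hj⟩ := (DirectLimit.exists_eq_one _).1 hx
  refine ⟨j, fun k hjk h => ?_⟩
  have := DirectedSystem.map_map (f := fun _ _ h => seqMap φ h) hij hjk x
  rw [← this]
  change seqMap φ hjk (seqMap φ hij x) = 1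
  have hj : seqMap φ hij x = 1 := hj
  rw [hj, map_one]

end Limit

section Main

open GTree

variable {G : ℕ → Type u} [∀ k, Group (G k)] {V : ℕ → Type v} [∀ k, MulAction (G k) (V k)]
  {S : ∀ k, SimpleGraph (V k)} (hS : ∀ k, IsTreeAction (G k) (S k))
  (F : ∀ k, TreeEpimorphism (G k) (S k) (G (k + 1)) (S (k + 1)))

/-- The map `G 0 → G k`. -/
def baseHom (k : ℕ) : G 0 →* G k := seqMap (fun k => (F k).hom) (Nat.zero_le k)

/-- The tree `S k`, with the action of `G 0`. -/
def baseTree (k : ℕ) : GTree.{u, v} (G 0) where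
  V := V k
  act := MulAction.compHom (V k) (baseHom F k)
  graph := S k
  isTreeAction :=
    let _ := MulAction.compHom (V k) (baseHom F k)
    ⟨(hS k).isTree, fun g _ _ h => (hS k).smul_adj (baseHom F k g) h,
      fun g _ _ h => (hS k).no_inversion (baseHom F k g) h⟩

theorem baseHom_succ (k : ℕ) (g : G 0) : baseHom F (k + 1) g = (F k).hom (baseHom F k g) :=
  congrArg (fun ψ => ψ g) (seqMap_succ (fun k => (F k).hom) (Nat.zero_le k))

theorem baseHom_surjective (k : ℕ) : Function.Surjective (baseHom F k) :=
  seqMap_surjective _ (fun k => (F k).hom_surjective) _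

theorem toSeqLimit_baseHom (k : ℕ) (g : G 0) :
    toSeqLimit (fun k => (F k).hom) k (baseHom F k g) = toSeqLimit (fun k => (F k).hom) 0 g :=
  toSeqLimit_seqMap _ _ g

theorem mem_ker_of_baseHom {k : ℕ} {g : G 0} (hg : baseHom F k g = 1) :
    g ∈ (toSeqLimit (fun k => (F k).hom) 0).ker := by
  rw [MonoidHom.mem_ker, ← toSeqLimit_baseHom F k, hg, map_one]

theorem exists_baseHom_eq_one {g : G 0} (hg : g ∈ (toSeqLimit (fun k => (F k).hom) 0).ker) :
    ∃ j, ∀ k, j ≤ k → baseHom F k g = 1 := by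
  obtain ⟨j, hj⟩ := exists_seqMap_eq_one _ (MonoidHom.mem_ker.1 hg)
  exact ⟨j, fun k hk => hj k hk _⟩

/-- The map of vertices `S k → S (k + 1)`. -/
def stepMap (k : ℕ) : (baseTree hS F k).V → (baseTree hS F (k + 1)).V := (F k).vertexMap

theorem stepMap_smul (k : ℕ) (g : G 0) (x : (baseTree hS F k).V) :
    stepMap hS F k (g • x) = g • stepMap hS F k x := by
  change (F k).vertexMap (baseHom F k g • (show V k from x)) =
    baseHom F (k + 1) g • (F k).vertexMap x
  rw [(F k).vertexMap_smul, baseHom_succ]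

theorem isFold_stepMap (hF : ∀ k, (F k).PreservesEdgeStabilizers) (k : ℕ) :
    IsFold (toSeqLimit (fun k => (F k).hom) 0).ker (stepMap hS F k) where
  map_smul := stepMap_smul hS F k
  lift {x y} hxy {p q} hpq g hp hq := by
    have hmem := hpq.mem_edges (hS (k + 1)).isTree ((F k).edgeMap hxy)
    have hg : baseHom F (k + 1) g ∈ edgeStabilizer (G (k + 1)) (V := V (k + 1)) p q := ⟨hp, hq⟩
    rw [hF k hxy p q hmem, baseHom_succ] at hg
    obtain ⟨a, ⟨ha1, ha2⟩, ha⟩ := hg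
    obtain ⟨b, rfl⟩ := baseHom_surjective F k a
    refine ⟨b * g⁻¹, mem_ker_of_baseHom F (k := k + 1) ?_, ?_, ?_⟩
    · rw [baseHom_succ, map_mul, map_mul, ha, map_inv, map_inv, mul_inv_cancel]
    · rw [inv_mul_cancel_right]
      exact ha1
    · rw [inv_mul_cancel_right]
      exact ha2

theorem exists_equivariant_map {i j : ℕ} (hij : i ≤ j) :
    ∃ f : (baseTree hS F i).V → (baseTree hS F j).V, ∀ (g : G 0) x, f (g • x) = g • f x := by
  induction j, hij using Nat.le_induction with
  | base => exact ⟨id, fun _ _ => rfl⟩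
  | succ j _ ih =>
    obtain ⟨f, hf⟩ := ih
    exact ⟨fun x => stepMap hS F j (f x), fun g x =>
      (congrArg (stepMap hS F j) (hf g x)).trans (stepMap_smul hS F j g (f x))⟩

/-- A vertex of `S k` cannot be fixed by `G 0` modulo the kernel of the map to the limit: by finite
generation its image in some `S l` would be a fixed vertex. -/
theorem not_fixed_mod_ker [Group.FG (G 0)] (hnontrivial : ∀ k, IsNontrivialAction (G k) (V k))
    (k : ℕ) (x : (baseTree hS F k).V) :
    ¬ ∀ g : G 0, ∃ n ∈ (toSeqLimit (fun k => (F k).hom) 0).ker, (n * g) • x = x := by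
  intro hfix
  choose n hn hnx using hfix
  obtain ⟨A, hA, hAfin⟩ := (Group.fg_iff (G := G 0)).1 inferInstance
  choose! j hj using fun a (_ : a ∈ A) => exists_baseHom_eq_one F (hn a)
  obtain ⟨J, hJ⟩ := (hAfin.image j).bddAbove
  obtain ⟨f, hf⟩ := exists_equivariant_map hS F (le_max_left k J)
  have hgen : A ⊆ MulAction.stabilizer (G 0) (f x) := by
    intro a ha
    have hna : baseHom F (max k J) (n a) = 1 :=
      hj a ha _ ((hJ ⟨a, ha, rfl⟩).trans (le_max_right _ _))
    have htriv : ∀ v : (baseTree hS F (max k J)).V, n a • v = v := by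
      intro v
      change baseHom F (max k J) (n a) • (show V (max k J) from v) = v
      rw [hna, one_smul]
    change a • f x = f x
    rw [← htriv (a • f x), ← mul_smul, ← hf, hnx]
  have htop : (⊤ : Subgroup (G 0)) ≤ MulAction.stabilizer (G 0) (f x) :=
    hA ▸ (Subgroup.closure_le _).2 hgen
  refine hnontrivial (max k J) ⟨f x, fun g => ?_⟩
  obtain ⟨h, rfl⟩ := baseHom_surjective F (max k J) g
  exact htop (Subgroup.mem_top h)

end Main

theorem mainTheorem2 (G : ℕ → Type u) [∀ k, Group (G k)] [∀ k, Group.FG (G k)]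
    (V : ℕ → Type v) [∀ k, MulAction (G k) (V k)] (S : ∀ k, SimpleGraph (V k))
    (hS : ∀ k, IsTreeAction (G k) (S k))
    (hnontrivial : ∀ k, IsNontrivialAction (G k) (V k))
    (F : ∀ k, TreeEpimorphism (G k) (S k) (G (k + 1)) (S (k + 1)))
    (hF : ∀ k, (F k).PreservesEdgeStabilizers) :
    ∃ (k : ℕ) (x y : V k), (S k).Adj x y ∧
      HasNontrivialSplittingOver.{u, v} (SeqLimit fun k => (F k).hom)
        ((edgeStabilizer (G k) x y).map (toSeqLimit (fun k => (F k).hom) k)) := by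
  set Φ := toSeqLimit (fun k => (F k).hom) 0 with hΦ
  have hΦs : Function.Surjective Φ := toSeqLimit_surjective _ (fun k => (F k).hom_surjective) 0
  -- the reductions of the trees `S k`
  choose R π hR hπ hπs hπadj hπfix hlift using
    fun k => GTree.exists_reduction Φ.ker (baseTree hS F k)
  have hmap : ∀ k, ∃ g : (R k).V → (R (k + 1)).V, GTree.IsFold Φ.ker g := fun k =>
    hlift k _ _ (hR (k + 1)) ((hπ (k + 1)).comp (isFold_stepMap hS F hF k))
  have hN : ∀ n ∈ Φ.ker, ∃ i, ∀ j, i ≤ j → ∀ v : (R j).V, n • v = v := by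
    intro n hn
    obtain ⟨i, hi⟩ := exists_baseHom_eq_one F hn
    refine ⟨i, fun j hij v => ?_⟩
    obtain ⟨x, rfl⟩ := hπs j v
    rw [← (hπ j).map_smul]
    refine congrArg (π j) ?_
    change baseHom F j n • (show V j from x) = x
    rw [hi j hij, one_smul]
  obtain ⟨T, k, f, hT, hf, htriv⟩ := GTree.exists_trivial_isFold hR hmap hN
  have hfix : ¬ ∃ v : (R k).V, ∀ h : G 0, h • v = v := by
    rintro ⟨v, hv⟩
    obtain ⟨x, rfl⟩ := hπs k v
    exact not_fixed_mod_ker hS F hnontrivial k x fun g => hπfix k g x (hv g)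
  obtain ⟨x, y, hxy, hfxy, hcol⟩ := GTree.exists_nontrivial_collapse hT hf.map_smul hfix
  -- an edge of `S k` whose image lies on the geodesic from `f x` to `f y`
  obtain ⟨p, q, hpq, hsep, -⟩ := exists_separates_of_ne (R k).isTree id hfxy
  obtain ⟨p', q', hpq', rfl, rfl⟩ := hπadj k p q hpq
  refine ⟨k, p', q', hpq', ?_⟩
  have hr := GTree.isTreeCongruence_collapse x y
  have hne := GTree.not_collapse_of_adj hxy
  have hstab : (edgeStabilizer (G k) (V := V k) p' q').map (toSeqLimit (fun k => (F k).hom) k) =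
      (edgeStabilizer (G 0) (T.proj hr x) (T.proj hr y)).map Φ := by
    ext g
    constructor
    · rintro ⟨a, ⟨ha1, ha2⟩, rfl⟩
      obtain ⟨b, rfl⟩ := baseHom_surjective F k a
      have hb1 : b • π k p' = π k p' := by
        rw [← (hπ k).map_smul]
        exact congrArg (π k) ha1
      have hb2 : b • π k q' = π k q' := by
        rw [← (hπ k).map_smul]
        exact congrArg (π k) ha2
      obtain ⟨n, hn, h1, h2⟩ := hf.lift hxy hsep b hb1 hb2
      rw [mul_smul, htriv n hn] at h1 h2
      refine ⟨b, ⟨congrArg (T.proj hr) h1, congrArg (T.proj hr) h2⟩, ?_⟩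
      exact (toSeqLimit_baseHom F k b).symm
    · rintro ⟨b, ⟨hb1, hb2⟩, rfl⟩
      obtain ⟨h1, h2⟩ := GTree.smul_eq_of_collapse hxy hne
        (Or.inl ⟨(GTree.proj_eq_iff hr).1 hb1, (GTree.proj_eq_iff hr).1 hb2⟩)
      obtain ⟨h3, h4⟩ := (R k).isTreeAction.fixed_of_separates
        (by rw [← hf.map_smul, h1]) (by rw [← hf.map_smul, h2]) hsep
      obtain ⟨n, hn, h5, h6⟩ := (hπ k).lift hpq'
        ((separates_iff_of_adj (R k).isTree hpq).2 rfl) b h3 h4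
      refine ⟨baseHom F k (n * b), ⟨h5, h6⟩, ?_⟩
      rw [toSeqLimit_baseHom, ← hΦ, map_mul, MonoidHom.mem_ker.1 hn, one_mul]
  rw [hstab]
  refine GTree.hasNontrivialSplittingOver_of_surjective (T := T.quot hr) hΦs ?_ ?_ ?_
    (GTree.adj_proj hr hxy hne)
  · intro n hn v
    obtain ⟨w, rfl⟩ := GTree.proj_surjective hr v
    rw [← GTree.proj_smul, htriv n hn]
  · rintro ⟨v, hv⟩
    obtain ⟨w, rfl⟩ := GTree.proj_surjective hr v
    exact hcol ⟨w, fun h => (GTree.proj_eq_iff hr).1 (hv h).symm⟩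
  · intro a b a' b' hab hab'
    obtain ⟨v, w, hvw, hvwne, rfl, rfl⟩ := GTree.quot_adj hr hab
    obtain ⟨v', w', hvw', hvwne', rfl, rfl⟩ := GTree.quot_adj hr hab'
    obtain ⟨g, hg⟩ := GTree.exists_mk_eq_of_not_collapse hvw hvwne
    obtain ⟨g', hg'⟩ := GTree.exists_mk_eq_of_not_collapse hvw' hvwne'
    have key : s((g' * g⁻¹) • v, (g' * g⁻¹) • w) = s(v', w') := by
      rw [hg', mul_smul, mul_smul, smul_mk_eq_iff, ← smul_mk_eq_iff g, smul_inv_smul,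
        smul_inv_smul, hg]
    refine ⟨g' * g⁻¹, ?_⟩
    rw [← GTree.proj_smul, ← GTree.proj_smul]
    rcases Sym2.eq_iff.1 key with ⟨h1, h2⟩ | ⟨h1, h2⟩
    · exact Or.inl ⟨by rw [h1], by rw [h2]⟩
    · exact Or.inr ⟨by rw [h1], by rw [h2]⟩
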